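/- **Setting.** For every $N$ let $X_N$ be a random $N\times N$ self-adjoint complex matrix with eigenvalues $\lambda_1,\dots,\lambda_N$, and put $\mathrm{Tr} f(X_N)=\sum_k f(\lambda_k)$ for $f:\mathbb{R}\to\mathbb{C}$. For complex random variables let $\mathrm{Cov}(Y,Z)=\mathbb{E}(YZ)-\mathbb{E}(Y)\mathbb{E}(Z)$ and $\mathrm{Var}(Z)=\mathbb{E}|Z-\mathbb{E}Z|^2$. $C^1(\mathbb{R})$ denotes the complex valued continuously differentiable functions on $\mathbb{R}$, and $C^1([-M,M])=\{f|_M : f\in C^1(\mathbb{R})\}$, where $f|_M$ is the restriction of $f$ to $[-M,M]$; $\|h\|_M=\sup_{|x|\le M}|h(x)|$. Assume: * **A0.** All $\mathrm{Tr}(X_N^n)$ are integrable and, for all $m,n$, the limits $\alpha_n=\lim_{N}\frac1N\mathbb{E}\,\mathrm{Tr}(X_N^n)$ and $\alpha_{m,n}=\lim_N\mathrm{Cov}(\mathrm{Tr}(X_N^m),\mathrm{Tr}(X_N^n))$ exist. * **A1.** $M>0$ and $\lim_{N\to\infty}N^8\Pr(\|X_N\|>M)=0$, where $\|\cdot\|$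 is the operator norm. * **A2.** $K>0$ and $\mathrm{Var}(\mathrm{Tr} f(X_N))\le K\|f'\|_\infty^2$ for all $f\in C^1(\mathbb{R})$ and all $N$ (the right side being $\infty$ if $f'$ is unbounded). Let $\rho$ be the bilinear form on $\mathbb{C}[x]\times\mathbb{C}[x]$ with $\rho(x^m,x^n)=\alpha_{m,n}$. **Bounded Fréchet variation and the Fréchet integral.** For $u:[-M,M]^2\to\mathbb{R}$ let $\Delta u(s_0,s_1;t_0,t_1)=u(s_1,t_1)-u(s_1,t_0)-u(s_0,t_1)+u(s_0,t_0)$. The function $u$ has bounded Fréchet variation if the sums $\sum_{i,j}\sigma_i\theta_j\,\Delta u(s_{i-1},s_i;t_{j-1},t_j)$ are uniformly bounded over all partitions $-M=s_0\le\dots\le s_m=M$, $-M=t_0\le\dots\le t_n=M$ and all signs $\sigma_i,\theta_j\in\{\pm1\}$. The Fréchet integral $\int_{-M}^M\int_{-M}^M f(x)g(y)\,du(x,y)$ is the limit of $\sum_{i,j}f(\xi_i)g(\eta_j)\,\Delta u(s_{i-1},s_i;t_{j-1},t_j)$, with arbitrary $\xi_i\in[s_{i-1},s_i]$ and $\eta_j\in[t_{j-1},t_j]$,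 as the meshes of both partitions tend to $0$. **Theorem.** Under A0, A1 and A2: (a) $\rho$ extends to a bilinear form on $C^1([-M,M])\times C^1([-M,M])$ (that is, $\rho(p|_M,q|_M)=\rho(p,q)$ for all $p,q\in\mathbb{C}[x]$) with $|\rho(f,g)|\le K\|f'\|_M\|g'\|_M$ for all $f,g\in C^1([-M,M])$. (b) For all polynomially bounded $f,g\in C^1(\mathbb{R})$, the variables $\mathrm{Tr} f(X_N)$ and $\mathrm{Tr} g(X_N)$ are square integrable and $$\lim_{N\to\infty}\mathrm{Cov}(\mathrm{Tr} f(X_N),\mathrm{Tr} g(X_N))=\rho(f|_M,g|_M).$$ (c) There is a function $u:[-M,M]^2\to\mathbb{R}$ of bounded Fréchet variation such that, for all $f,g\in C^1([-M,M])$, the following Fréchet integral exists and $$\rho(f,g)=\int_{-M}^{M}\int_{-M}^{M}f'(x)\,g'(y)\,du(x,y).$$ -/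

import Mathlib

open MeasureTheory Filter Topology
open scoped ENNReal Polynomial

namespace SecondOrder

noncomputable section

/-! ### Random variables: covariance and variance -/

/-- The (bilinear) covariance `Cov(Y, Z) = E(YZ) - E(Y) E(Z)` of complex random variables. -/
def cov {Ω : Type*} [MeasurableSpace Ω] (P : Measure Ω) (Y Z : Ω → ℂ) : ℂ :=
  (∫ ω, Y ω * Z ω ∂P) - (∫ ω, Y ω ∂P) * ∫ ω, Z ω ∂P

/-- The variance `E |Z - E Z|²` of a complex random variable, with values in `[0, ∞]`. -/
def var {Ω : Type*} [MeasurableSpace Ω] (P : Measure Ω) (Z : Ω → ℂ) : ℝ≥0∞ :=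
  ∫⁻ ω, ‖Z ω - ∫ ω', Z ω' ∂P‖ₑ ^ 2 ∂P

/-! ### Self-adjoint random matrix ensembles -/

/-- A self-adjoint random matrix ensemble: for every `N` a random `N × N` Hermitian matrix `X N`,
defined on some probability space `(Ω N, P N)`, with measurable entries. -/
structure IsSelfAdjointEnsemble {Ω : ℕ → Type*} [∀ N, MeasurableSpace (Ω N)]
    (P : ∀ N, Measure (Ω N)) (X : ∀ N, Ω N → Matrix (Fin N) (Fin N) ℂ) : Prop where
  prob : ∀ N, IsProbabilityMeasure (P N)
  measurable_entry : ∀ N i j, Measurable fun ω => X N ω i j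
  hermitian : ∀ N ω, (X N ω).IsHermitian

/-- `Tr f(A) = ∑ₖ f(λₖ)`, the sum over the eigenvalues of the Hermitian matrix `A`,
counted with multiplicity. -/
def trFun {n : ℕ} {A : Matrix (Fin n) (Fin n) ℂ} (hA : A.IsHermitian) (f : ℝ → ℂ) : ℂ :=
  ∑ k, f (hA.eigenvalues k)

/-- The linear statistic `Tr f(X_N)` as a random variable. -/
def linStat {Ω : ℕ → Type*} {X : ∀ N, Ω N → Matrix (Fin N) (Fin N) ℂ}
    (hX : ∀ N ω, (X N ω).IsHermitian) (f : ℝ → ℂ) (N : ℕ) (ω : Ω N) : ℂ :=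
  trFun (hX N ω) f

/-- The first order moments `a n` and the second order moments `α m n` of the ensemble exist:
all traces of powers are integrable, and `a n`, `α m n` are the limits of
`N⁻¹ E Tr X_N^n` and of `Cov(Tr X_N^m, Tr X_N^n)`. -/
structure HasMoments {Ω : ℕ → Type*} [∀ N, MeasurableSpace (Ω N)]
    (P : ∀ N, Measure (Ω N)) (X : ∀ N, Ω N → Matrix (Fin N) (Fin N) ℂ)
    (a : ℕ → ℂ) (α : ℕ → ℕ → ℂ) : Prop where
  integrable : ∀ N n : ℕ, Integrable (fun ω => (X N ω ^ n).trace) (P N)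
  first : ∀ n : ℕ,
    Tendsto (fun N : ℕ => (1 / (N : ℂ)) * ∫ ω, (X N ω ^ n).trace ∂(P N)) atTop (𝓝 (a n))
  second : ∀ m n : ℕ,
    Tendsto (fun N : ℕ => cov (P N) (fun ω => (X N ω ^ m).trace) (fun ω => (X N ω ^ n).trace))
      atTop (𝓝 (α m n))

/-- The operator norm of a matrix, with respect to the Euclidean norm. -/
def opNorm {n : ℕ} (A : Matrix (Fin n) (Fin n) ℂ) : ℝ :=
  ‖Matrix.toEuclideanCLM (n := Fin n) (𝕜 := ℂ) A‖

/-- `N⁸ Pr(‖X_N‖ > M) → 0`. -/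
def NormConcentrated {Ω : ℕ → Type*} [∀ N, MeasurableSpace (Ω N)]
    (P : ∀ N, Measure (Ω N)) (X : ∀ N, Ω N → Matrix (Fin N) (Fin N) ℂ) (M : ℝ) : Prop :=
  Tendsto (fun N : ℕ => (N : ℝ) ^ 8 * (P N).real {ω | M < opNorm (X N ω)}) atTop (𝓝 0)

/-- `Var Tr f(X_N) ≤ K ‖f'‖_∞²` for all complex valued `f ∈ C¹(ℝ)` and all `N`; the inequality is
one in `[0, ∞]`, and holds trivially when `f'` is unbounded (`K` is positive). -/
def PoincareBound {Ω : ℕ → Type*} [∀ N, MeasurableSpace (Ω N)]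
    (P : ∀ N, Measure (Ω N)) {X : ∀ N, Ω N → Matrix (Fin N) (Fin N) ℂ}
    (hX : ∀ N ω, (X N ω).IsHermitian) (K : ℝ) : Prop :=
  ∀ f : ℝ → ℂ, ContDiff ℝ 1 f → ∀ N : ℕ,
    var (P N) (linStat hX f N) ≤ ENNReal.ofReal K * (⨆ x : ℝ, ‖deriv f x‖ₑ) ^ 2

/-- Polynomially bounded functions. -/
def PolyBounded (f : ℝ → ℂ) : Prop :=
  ∃ (C : ℝ) (k : ℕ), ∀ x : ℝ, ‖f x‖ ≤ C * (1 + |x|) ^ k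

/-- The bilinear extension of `(x^m, x^n) ↦ α m n` to `ℂ[x] × ℂ[x]`. -/
def polyRho (α : ℕ → ℕ → ℂ) (p q : ℂ[X]) : ℂ :=
  p.sum fun m b => q.sum fun n c => b * c * α m n

/-! ### The space `C¹([-M, M])` -/

/-- The interval `[-M, M]`. -/
abbrev Seg (M : ℝ) : Type := Set.Icc (-M) M

/-- `C¹([-M, M])`: the restrictions to `[-M, M]` of the functions in `C¹(ℝ)`. -/
def C1 (M : ℝ) : Submodule ℂ (Seg M → ℂ) where
  carrier := {h | ∃ F : ℝ → ℂ, ContDiff ℝ 1 F ∧ ∀ x : Seg M, h x = F x}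
  zero_mem' := ⟨fun _ => 0, contDiff_const, fun _ => rfl⟩
  add_mem' := by
    rintro h₁ h₂ ⟨F₁, c₁, e₁⟩ ⟨F₂, c₂, e₂⟩
    exact ⟨fun x => F₁ x + F₂ x, c₁.add c₂, fun x => by simp [e₁ x, e₂ x]⟩
  smul_mem' := by
    rintro c h ⟨F, cF, e⟩
    exact ⟨fun x => c • F x, cF.const_smul c, fun x => by simp [e x]⟩

/-- The restriction `f|_M ∈ C¹([-M, M])` of `f ∈ C¹(ℝ)`. -/
def restr (M : ℝ) (f : ℝ → ℂ) (hf : ContDiff ℝ 1 f) : C1 M :=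
  ⟨fun x => f x, f, hf, fun _ => rfl⟩

theorem contDiff_polyFun (p : ℂ[X]) : ContDiff ℝ 1 fun x : ℝ => p.eval (x : ℂ) := by
  have h : ContDiff ℝ 1 fun x : ℝ => (x : ℂ) := Complex.ofRealCLM.contDiff
  have h2 : ContDiff ℝ 1 fun z : ℂ => p.eval z := by
    simpa using (p.contDiff_aeval (R := ℂ) (𝕜 := ℂ) 1).restrict_scalars ℝ
  exact h2.comp h

/-- The restriction of a polynomial function to `[-M, M]`. -/
def polyRestr (M : ℝ) (p : ℂ[X]) : C1 M :=
  restr M (fun x => p.eval (x : ℂ)) (contDiff_polyFun p)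

/-- The derivative `f'` of a function on `[-M, M]` (one-sided at the end points). -/
def dSeg {M : ℝ} (f : Seg M → ℂ) (x : Seg M) : ℂ :=
  derivWithin (Function.extend Subtype.val f 0) (Set.Icc (-M) M) x

/-- `‖f‖_M = sup_{|x| ≤ M} |f x|`. -/
def supNorm {M : ℝ} (f : Seg M → ℂ) : ℝ := ⨆ x : Seg M, ‖f x‖

/-! ### Fréchet variation and Fréchet integral -/

/-- A partition `-M = s₀ ≤ s₁ ≤ ⋯ ≤ s_n = M`. -/
structure Partn (M : ℝ) where
  n : ℕ
  pt : Fin (n + 1) → Seg M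
  mono : Monotone pt
  first : (pt 0 : ℝ) = -M
  last : (pt (Fin.last n) : ℝ) = M

/-- `|s| < δ`, where `|s|` is the maximal length of the intervals of the partition `s`
(used for `δ > 0`). -/
def Partn.MeshLT {M : ℝ} (s : Partn M) (δ : ℝ) : Prop :=
  ∀ i : Fin s.n, (s.pt i.succ : ℝ) - s.pt i.castSucc < δ

/-- `ξ` chooses a point in every interval of the partition `s`. -/
def Partn.IsTag {M : ℝ} (s : Partn M) (ξ : Fin s.n → Seg M) : Prop :=
  ∀ i : Fin s.n, s.pt i.castSucc ≤ ξ i ∧ ξ i ≤ s.pt i.succ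

/-- `Δu(s₀, s₁; t₀, t₁)`. -/
def rectDiff {M : ℝ} (u : Seg M → Seg M → ℝ) (s₀ s₁ t₀ t₁ : Seg M) : ℝ :=
  u s₁ t₁ - u s₁ t₀ - u s₀ t₁ + u s₀ t₀

/-- `u` has bounded Fréchet variation. -/
def BoundedFrechetVariation {M : ℝ} (u : Seg M → Seg M → ℝ) : Prop :=
  ∃ B : ℝ, ∀ (s t : Partn M) (σ : Fin s.n → ℝ) (θ : Fin t.n → ℝ),
    (∀ i, σ i = 1 ∨ σ i = -1) → (∀ j, θ j = 1 ∨ θ j = -1) →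
    |∑ i, ∑ j, σ i * θ j *
      rectDiff u (s.pt i.castSucc) (s.pt i.succ) (t.pt j.castSucc) (t.pt j.succ)| ≤ B

/-- The Fréchet integral `∫∫ f(x) g(y) du(x, y)` exists and equals `I`: the sums
`∑ᵢ ∑ⱼ f(ξᵢ) g(ηⱼ) Δu(sᵢ₋₁, sᵢ; tⱼ₋₁, tⱼ)` converge to `I` as `|s|, |t| → 0`, whatever the
choice of the points `ξᵢ ∈ [sᵢ₋₁, sᵢ]` and `ηⱼ ∈ [tⱼ₋₁, tⱼ]`. -/
def HasFrechetIntegral {M : ℝ} (u : Seg M → Seg M → ℝ) (f g : Seg M → ℂ) (I : ℂ) : Prop :=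
  ∀ ε > 0, ∃ δ > 0, ∀ s t : Partn M, s.MeshLT δ → t.MeshLT δ →
    ∀ (ξ : Fin s.n → Seg M) (η : Fin t.n → Seg M), s.IsTag ξ → t.IsTag η →
    ‖(∑ i, ∑ j, f (ξ i) * g (η j) *
      (rectDiff u (s.pt i.castSucc) (s.pt i.succ) (t.pt j.castSucc) (t.pt j.succ) : ℂ)) - I‖ < ε

end

end SecondOrder

open SecondOrder

/-!
The variance bound `PoincareBound` controls `Tr f(X_N)` by the supremum of `f'` over the whole
line, whereas a bound by the supremum over `[-M, M]` is needed. The two are reconciled by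
continuing `f` affinely off `[-M, M]` (`exists_isTest_eqOn`). The continuation differs from `f` by
a polynomially bounded function vanishing on `[-M, M]`, whose linear statistic is supported on the
event `‖X_N‖ > M`. Its fourth moment is `O(N⁴)`, because `N⁻¹ E Tr X_N^m` is bounded, so that
`NormConcentrated` sends its second moment to zero (`tendsto_integral_sq_linStat_of_eq_zero`).
Hence, asymptotically, the standard deviation of `Tr f(X_N)` is at most `√K ‖f'‖_M`
(`IsTest.eventually_sdev_le`).

By the Cauchy-Schwarz inequality the covariance is then asymptotically bounded by
`K ‖f'‖_M ‖g'‖_M`. The covariances of polynomials converge by `HasMoments`, and polynomials are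
dense for the seminorm `f ↦ ‖f'‖_M` by Weierstrass, so all covariances converge, to a limit that
depends only on the restrictions to `[-M, M]`. This limit is the bilinear form `ρ`
(`exists_limiting_cov`).

The integral representation holds for every bilinear form with that bound which is real on real
functions (`exists_frechet_representation`). The integrator `u(s, t)` is a limit of the values of
`ρ` on antiderivatives of continuous approximations of the indicator functions of `[-M, s]` and
`[-M, t]`. A Riemann-Stieltjes sum for `u` is a limit of values `ρ(F, G)`, where `F'` and `G'` are
smoothed step functions: pointwise convex combinations of the coefficients, which makes the
variation bounded by `K`, and which for fine partitions makes `F'` and `G'` uniformly close to `f'`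
and `g'`.
-/

namespace SecondOrder

/-! ### Eigenvalues -/

theorem trace_pow_eq_sum_eigenvalues {n : ℕ} {A : Matrix (Fin n) (Fin n) ℂ} (hA : A.IsHermitian)
    (m : ℕ) : (A ^ m).trace = ∑ k, (hA.eigenvalues k : ℂ) ^ m := by
  conv_lhs => rw [hA.spectral_theorem, ← map_pow, Unitary.conjStarAlgAut_apply,
    Matrix.trace_mul_cycle, Unitary.coe_star_mul_self, one_mul, Matrix.diagonal_pow,
    Matrix.trace_diagonal]
  rfl

theorem trFun_eval {n : ℕ} {A : Matrix (Fin n) (Fin n) ℂ} (hA : A.IsHermitian) (p : ℂ[X]) :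
    trFun hA (fun x => p.eval (x : ℂ)) = ∑ m ∈ p.support, p.coeff m * (A ^ m).trace := by
  simp only [trFun, trace_pow_eq_sum_eigenvalues hA, Finset.mul_sum, Polynomial.eval_eq_sum,
    Polynomial.sum]
  exact Finset.sum_comm

theorem abs_eigenvalues_le_opNorm {n : ℕ} {A : Matrix (Fin n) (Fin n) ℂ} (hA : A.IsHermitian)
    (k : Fin n) : |hA.eigenvalues k| ≤ opNorm A := by
  have h := (Matrix.toEuclideanCLM (n := Fin n) (𝕜 := ℂ) A).le_opNorm (hA.eigenvectorBasis k)
  have h2 : Matrix.toEuclideanCLM (n := Fin n) (𝕜 := ℂ) A (hA.eigenvectorBasis k)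
      = hA.eigenvalues k • hA.eigenvectorBasis k := by
    apply PiLp.ext
    intro i
    have := congrFun (hA.mulVec_eigenvectorBasis k) i
    simpa using this
  rw [h2, norm_smul, hA.eigenvectorBasis.orthonormal.1 k] at h
  simpa [opNorm] using h

/-! ### Polynomial approximation -/

theorem exists_complex_polynomial_near {f : ℝ → ℂ} (hf : Continuous f) (a b : ℝ) {ε : ℝ}
    (hε : 0 < ε) : ∃ p : ℂ[X], ∀ x ∈ Set.Icc a b, ‖p.eval (x : ℂ) - f x‖ < ε := by
  obtain ⟨p, hp⟩ := exists_polynomial_near_of_continuousOn a b (fun x => (f x).re)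
    (Complex.continuous_re.comp hf).continuousOn (ε / 2) (by positivity)
  obtain ⟨q, hq⟩ := exists_polynomial_near_of_continuousOn a b (fun x => (f x).im)
    (Complex.continuous_im.comp hf).continuousOn (ε / 2) (by positivity)
  refine ⟨p.map Complex.ofRealHom + Polynomial.C Complex.I * q.map Complex.ofRealHom,
    fun x hx => ?_⟩
  have e (r : ℝ[X]) : (r.map Complex.ofRealHom).eval (x : ℂ) = ((r.eval x : ℝ) : ℂ) :=
    Polynomial.eval_map_apply (p := r) Complex.ofRealHom x
  have : (p.map Complex.ofRealHom + Polynomial.C Complex.I * q.map Complex.ofRealHom).eval (x : ℂ)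
      - f x = ((p.eval x - (f x).re : ℝ) : ℂ) + Complex.I * ((q.eval x - (f x).im : ℝ) : ℂ) := by
    rw [Polynomial.eval_add, Polynomial.eval_mul, Polynomial.eval_C, e, e]
    conv_lhs => rw [← Complex.re_add_im (f x)]
    push_cast
    ring
  rw [this]
  refine (norm_add_le _ _).trans_lt ?_
  rw [norm_mul, Complex.norm_I, one_mul, Complex.norm_real, Complex.norm_real]
  have h1 := hp x hx
  have h2 := hq x hx
  simp only [Real.norm_eq_abs]
  linarith

theorem exists_derivative_eq (q : ℂ[X]) : ∃ p : ℂ[X], p.derivative = q := by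
  induction q using Polynomial.induction_on' with
  | add p q hp hq =>
    obtain ⟨P, hP⟩ := hp
    obtain ⟨Q, hQ⟩ := hq
    exact ⟨P + Q, by rw [Polynomial.derivative_add, hP, hQ]⟩
  | monomial n c =>
    refine ⟨Polynomial.monomial (n + 1) (c / (n + 1)), ?_⟩
    rw [Polynomial.derivative_monomial]
    have : (n : ℂ) + 1 ≠ 0 := Nat.cast_add_one_ne_zero n
    simp [this]

/-! ### Covariance and standard deviation -/

/-- The standard deviation of a complex random variable (`0` if the variance is infinite). -/
noncomputable def sdev {Ω : Type*} [MeasurableSpace Ω] (P : Measure Ω) (Y : Ω → ℂ) : ℝ :=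
  √ (var P Y).toReal

section Variance

variable {Ω : Type*} [MeasurableSpace Ω] {P : Measure Ω} {Y Z : Ω → ℂ}

theorem sdev_nonneg : 0 ≤ sdev P Y := Real.sqrt_nonneg _

theorem sdev_eq_toReal_eLpNorm :
    sdev P Y = (eLpNorm (fun ω => Y ω - ∫ ω', Y ω' ∂P) 2 P).toReal := by
  rw [eLpNorm_eq_lintegral_rpow_enorm_toReal (by simp) (by simp), sdev, var,
    ← ENNReal.toReal_rpow, Real.sqrt_eq_rpow]
  simp

theorem cov_comm (Y Z : Ω → ℂ) : cov P Y Z = cov P Z Y := by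
  simp only [cov, mul_comm]

theorem cov_const_mul_left (c : ℂ) : cov P (fun ω => c * Y ω) Z = c * cov P Y Z := by
  simp only [cov, mul_assoc, integral_const_mul, mul_sub]

theorem cov_conj : cov P (fun ω => starRingEnd ℂ (Y ω)) (fun ω => starRingEnd ℂ (Z ω))
    = starRingEnd ℂ (cov P Y Z) := by
  simp only [cov, map_sub, map_mul, ← integral_conj]

theorem norm_integral_mul_le (hY : MemLp Y 2 P) (hZ : MemLp Z 2 P) :
    ‖∫ ω, Y ω * Z ω ∂P‖ ≤ (eLpNorm Y 2 P).toReal * (eLpNorm Z 2 P).toReal := by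
  have h : eLpNorm (Y • Z) 1 P ≤ eLpNorm Y 2 P * eLpNorm Z 2 P :=
    eLpNorm_smul_le_mul_eLpNorm hZ.1 hY.1
  rw [eLpNorm_one_eq_lintegral_enorm] at h
  rw [← ENNReal.toReal_mul, ← toReal_enorm]
  exact ENNReal.toReal_mono (ENNReal.mul_ne_top hY.eLpNorm_ne_top hZ.eLpNorm_ne_top)
    ((enorm_integral_le_lintegral_enorm _).trans h)

variable [IsProbabilityMeasure P]

theorem sdev_add_le (hY : MemLp Y 2 P) (hZ : MemLp Z 2 P) :
    sdev P (fun ω => Y ω + Z ω) ≤ sdev P Y + sdev P Z := by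
  have hY' : MemLp (fun ω => Y ω - ∫ ω', Y ω' ∂P) 2 P := hY.sub (memLp_const _)
  have hZ' : MemLp (fun ω => Z ω - ∫ ω', Z ω' ∂P) 2 P := hZ.sub (memLp_const _)
  simp only [sdev_eq_toReal_eLpNorm]
  rw [← ENNReal.toReal_add hY'.2.ne hZ'.2.ne]
  refine ENNReal.toReal_mono (ENNReal.add_ne_top.2 ⟨hY'.2.ne, hZ'.2.ne⟩) ?_
  have : (fun ω => Y ω + Z ω - ∫ ω', (Y ω' + Z ω') ∂P) =
      (fun ω => Y ω - ∫ ω', Y ω' ∂P) + fun ω => Z ω - ∫ ω', Z ω' ∂P := by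
    ext ω
    rw [integral_add (hY.integrable (by norm_num)) (hZ.integrable (by norm_num))]
    simp only [Pi.add_apply]
    ring
  rw [this]
  exact eLpNorm_add_le hY'.1 hZ'.1 (by norm_num)

theorem sdev_le_two_mul_sqrt (hY : MemLp Y 2 P) : sdev P Y ≤ 2 * √ (∫ ω, ‖Y ω‖ ^ 2 ∂P) := by
  have e : (eLpNorm Y 2 P).toReal = √ (∫ ω, ‖Y ω‖ ^ 2 ∂P) := by
    rw [hY.eLpNorm_eq_integral_rpow_norm (by simp) (by simp),
      ENNReal.toReal_ofReal (by positivity), Real.sqrt_eq_rpow]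
    simp
  have h1 : eLpNorm (fun ω => Y ω - ∫ ω', Y ω' ∂P) 2 P ≤ eLpNorm Y 2 P + eLpNorm Y 2 P := by
    refine (eLpNorm_sub_le hY.1 aestronglyMeasurable_const (by norm_num)).trans ?_
    gcongr
    rw [eLpNorm_const _ (by norm_num) (IsProbabilityMeasure.ne_zero P)]
    simp only [measure_univ, ENNReal.one_rpow, mul_one]
    refine (enorm_integral_le_lintegral_enorm _).trans ?_
    rw [← eLpNorm_one_eq_lintegral_enorm]
    exact eLpNorm_le_eLpNorm_of_exponent_le (by norm_num) hY.1
  rw [sdev_eq_toReal_eLpNorm, ← e, two_mul, ← ENNReal.toReal_add hY.2.ne hY.2.ne]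
  exact ENNReal.toReal_mono (ENNReal.add_ne_top.2 ⟨hY.2.ne, hY.2.ne⟩) h1

theorem cov_eq_integral_sub_mul_sub (hY : MemLp Y 2 P) (hZ : MemLp Z 2 P) :
    cov P Y Z = ∫ ω, (Y ω - ∫ ω', Y ω' ∂P) * (Z ω - ∫ ω', Z ω' ∂P) ∂P := by
  have iY := hY.integrable (by norm_num : (1 : ℝ≥0∞) ≤ 2)
  have iZ := hZ.integrable (by norm_num : (1 : ℝ≥0∞) ≤ 2)
  have iYZ : Integrable (fun ω => Y ω * Z ω) P := hY.integrable_mul hZ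
  rw [cov]
  set a := ∫ ω, Y ω ∂P with ha
  set b := ∫ ω, Z ω ∂P with hb
  have key : ∀ ω, (Y ω - a) * (Z ω - b) = Y ω * Z ω - (b * Y ω + a * Z ω - a * b) :=
    fun ω => by ring
  have i1 : Integrable (fun ω => b * Y ω + a * Z ω) P := (iY.const_mul b).add (iZ.const_mul a)
  have i2 : Integrable (fun ω => b * Y ω + a * Z ω - a * b) P := i1.sub (integrable_const _)
  simp only [key]
  rw [integral_sub iYZ i2, integral_sub i1 (integrable_const _),
    integral_add (iY.const_mul b) (iZ.const_mul a), integral_const_mul, integral_const_mul,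
    ← ha, ← hb]
  simp
  ring

theorem norm_cov_le (hY : MemLp Y 2 P) (hZ : MemLp Z 2 P) :
    ‖cov P Y Z‖ ≤ sdev P Y * sdev P Z := by
  rw [cov_eq_integral_sub_mul_sub hY hZ, sdev_eq_toReal_eLpNorm, sdev_eq_toReal_eLpNorm]
  exact norm_integral_mul_le (hY.sub (memLp_const _)) (hZ.sub (memLp_const _))

theorem cov_add_left {Y' : Ω → ℂ} (hY : MemLp Y 2 P) (hY' : MemLp Y' 2 P) (hZ : MemLp Z 2 P) :
    cov P (fun ω => Y ω + Y' ω) Z = cov P Y Z + cov P Y' Z := by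
  have iYZ : Integrable (fun ω => Y ω * Z ω) P := hY.integrable_mul hZ
  have iYZ' : Integrable (fun ω => Y' ω * Z ω) P := hY'.integrable_mul hZ
  simp only [cov, add_mul]
  rw [integral_add iYZ iYZ',
    integral_add (hY.integrable (by norm_num)) (hY'.integrable (by norm_num))]
  ring

theorem cov_sum_left {ι : Type*} (s : Finset ι) {Y : ι → Ω → ℂ} (hY : ∀ i ∈ s, MemLp (Y i) 2 P)
    (hZ : MemLp Z 2 P) : cov P (fun ω => ∑ i ∈ s, Y i ω) Z = ∑ i ∈ s, cov P (Y i) Z := by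
  simp only [cov, Finset.sum_mul]
  have h (i) (hi : i ∈ s) : Integrable (fun ω => Y i ω * Z ω) P := (hY i hi).integrable_mul hZ
  rw [integral_finsetSum _ h,
    integral_finsetSum _ fun i hi => (hY i hi).integrable (by norm_num), Finset.sum_mul,
    Finset.sum_sub_distrib]

end Variance

/-! ### Moments of linear statistics -/

section LinearStatistics

variable {Ω : ℕ → Type*} {X : ∀ N, Ω N → Matrix (Fin N) (Fin N) ℂ}
  (hX : ∀ N ω, (X N ω).IsHermitian)

theorem linStat_apply (f : ℝ → ℂ) (N : ℕ) (ω : Ω N) :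
    linStat hX f N ω = ∑ k, f ((hX N ω).eigenvalues k) := rfl

theorem linStat_eval (p : ℂ[X]) (N : ℕ) :
    linStat hX (fun x => p.eval (x : ℂ)) N
      = fun ω => ∑ m ∈ p.support, p.coeff m * (X N ω ^ m).trace :=
  funext fun ω => trFun_eval (hX N ω) p

theorem linStat_add (f g : ℝ → ℂ) (N : ℕ) :
    linStat hX (fun x => f x + g x) N = fun ω => linStat hX f N ω + linStat hX g N ω :=
  funext fun _ => by simp only [linStat_apply, Finset.sum_add_distrib]

theorem linStat_const_mul (c : ℂ) (f : ℝ → ℂ) (N : ℕ) :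
    linStat hX (fun x => c * f x) N = fun ω => c * linStat hX f N ω :=
  funext fun _ => by simp only [linStat_apply, Finset.mul_sum]

theorem linStat_conj (f : ℝ → ℂ) (N : ℕ) :
    linStat hX (fun x => starRingEnd ℂ (f x)) N = fun ω => starRingEnd ℂ (linStat hX f N ω) :=
  funext fun _ => by simp only [linStat_apply, map_sum]

/-- The power mean inequality over the eigenvalues reduces `|Tr f|⁴` to a trace of a power. -/
theorem exists_norm_linStat_pow_four_le {f : ℝ → ℂ} (hf : PolyBounded f) :
    ∃ (D : ℝ) (m : ℕ), 0 ≤ D ∧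
      ∀ N ω, ‖linStat hX f N ω‖ ^ 4 ≤ D * N ^ 3 * (N + ((X N ω ^ m).trace).re) := by
  obtain ⟨C, k, hC⟩ := hf
  have hC0 : 0 ≤ C := by simpa using (norm_nonneg _).trans (hC 0)
  refine ⟨C ^ 4 * 2 ^ (4 * k), 4 * k, by positivity, fun N ω => ?_⟩
  have hpt (x : ℝ) : ‖f x‖ ^ 4 ≤ C ^ 4 * 2 ^ (4 * k) * (1 + x ^ (4 * k)) := by
    have h1 : ‖f x‖ ^ 4 ≤ (C * (1 + |x|) ^ k) ^ 4 :=
      pow_le_pow_left₀ (norm_nonneg _) (hC x) 4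
    have h2 : (1 + |x|) ^ (4 * k) ≤ 2 ^ (4 * k) * (1 + |x| ^ (4 * k)) := by
      refine (add_pow_le zero_le_one (abs_nonneg x) (4 * k)).trans ?_
      rw [one_pow]
      gcongr
      · norm_num
      · omega
    have h3 : |x| ^ (4 * k) = x ^ (4 * k) :=
      Even.pow_abs (Even.mul_right (by decide) k) x
    calc ‖f x‖ ^ 4 ≤ C ^ 4 * (1 + |x|) ^ (4 * k) := by
          rw [mul_pow, ← pow_mul, mul_comm k 4] at h1; exact h1
      _ ≤ C ^ 4 * (2 ^ (4 * k) * (1 + |x| ^ (4 * k))) := by gcongr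
      _ = _ := by rw [h3]; ring
  have htr : ((X N ω ^ (4 * k)).trace).re = ∑ i, (hX N ω).eigenvalues i ^ (4 * k) := by
    rw [trace_pow_eq_sum_eigenvalues (hX N ω), Complex.re_sum]
    refine Finset.sum_congr rfl fun i _ => ?_
    rw [← Complex.ofReal_pow, Complex.ofReal_re]
  have hpm : (∑ i, ‖f ((hX N ω).eigenvalues i)‖) ^ 4
      ≤ (N : ℝ) ^ 3 * ∑ i, ‖f ((hX N ω).eigenvalues i)‖ ^ 4 := by
    rcases N.eq_zero_or_pos with rfl | hN
    · simp
    · have hN' : (0 : ℝ) < (N : ℝ) ^ 3 := pow_pos (Nat.cast_pos.2 hN) 3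
      have h := pow_sum_div_card_le_sum_pow (s := Finset.univ)
        (f := fun i => ‖f ((hX N ω).eigenvalues i)‖) (fun i _ => norm_nonneg _) 3
      rwa [Finset.card_univ, Fintype.card_fin, div_le_iff₀' hN'] at h
  calc ‖linStat hX f N ω‖ ^ 4 ≤ (∑ i, ‖f ((hX N ω).eigenvalues i)‖) ^ 4 :=
        pow_le_pow_left₀ (norm_nonneg _) (by rw [linStat_apply]; exact norm_sum_le _ _) 4
    _ ≤ (N : ℝ) ^ 3 * ∑ i, ‖f ((hX N ω).eigenvalues i)‖ ^ 4 := hpm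
    _ ≤ (N : ℝ) ^ 3 * ∑ i, C ^ 4 * 2 ^ (4 * k) * (1 + (hX N ω).eigenvalues i ^ (4 * k)) := by
        gcongr; exact hpt _
    _ = _ := by
        rw [← Finset.mul_sum, Finset.sum_add_distrib, htr]
        simp
        ring

end LinearStatistics

section Ensemble

variable {Ω : ℕ → Type*} [∀ N, MeasurableSpace (Ω N)] {P : ∀ N, Measure (Ω N)}
  {X : ∀ N, Ω N → Matrix (Fin N) (Fin N) ℂ} {a : ℕ → ℂ} {α : ℕ → ℕ → ℂ} {M K : ℝ} {f g : ℝ → ℂ}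

theorem measurable_trace_pow (hX : IsSelfAdjointEnsemble P X) (N m : ℕ) :
    Measurable fun ω => (X N ω ^ m).trace := by
  have h : ∀ m i j, Measurable fun ω => (X N ω ^ m) i j := by
    intro m
    induction m with
    | zero => intro i j; simp
    | succ m ih =>
      intro i j
      simp only [pow_succ, Matrix.mul_apply]
      exact Finset.measurable_sum _ fun k _ => (ih i k).mul (hX.measurable_entry N k j)
  simp only [Matrix.trace, Matrix.diag]
  exact Finset.measurable_sum _ fun i _ => h m i i

/-- A continuous `f` is a pointwise limit of polynomials, for which `Tr p(X_N)` is a polynomial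
in the entries of `X_N`. -/
theorem measurable_linStat (hX : IsSelfAdjointEnsemble P X) (hf : Continuous f) (N : ℕ) :
    Measurable (linStat hX.hermitian f N) := by
  choose p hp using fun n : ℕ => exists_complex_polynomial_near hf (-(n : ℝ)) n
    (Nat.one_div_pos_of_nat (α := ℝ) (n := n))
  have hlim (x : ℝ) : Tendsto (fun n => (p n).eval (x : ℂ)) atTop (𝓝 (f x)) := by
    rw [tendsto_iff_norm_sub_tendsto_zero]
    refine squeeze_zero' (Eventually.of_forall fun _ => norm_nonneg _) ?_
      tendsto_one_div_add_atTop_nhds_zero_nat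
    obtain ⟨n₀, hn₀⟩ := exists_nat_ge |x|
    filter_upwards [eventually_ge_atTop n₀] with n hn
    have : |x| ≤ n := hn₀.trans (Nat.cast_le.2 hn)
    exact (hp n x (abs_le.1 this)).le
  refine measurable_of_tendsto_metrizable
    (f := fun n => linStat hX.hermitian (fun x => (p n).eval (x : ℂ)) N) (fun n => ?_)
    (tendsto_pi_nhds.2 fun ω => by
      simp only [linStat_apply]
      exact tendsto_finsetSum _ fun k _ => hlim _)
  rw [linStat_eval]
  exact Finset.measurable_sum _ fun m _ => (measurable_trace_pow hX N m).const_mul _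

/-- The moments grow at most linearly in `N`. -/
theorem exists_integral_trace_pow_le (hA0 : HasMoments P X a α) (m : ℕ) :
    ∃ B : ℝ, 0 ≤ B ∧ ∀ N, ∫ ω, ((X N ω ^ m).trace).re ∂(P N) ≤ B * N := by
  obtain ⟨B, hB⟩ := (hA0.first m).norm.bddAbove_range
  have hB' (N : ℕ) : ‖(1 / (N : ℂ)) * ∫ ω, (X N ω ^ m).trace ∂(P N)‖ ≤ B := hB ⟨N, rfl⟩
  refine ⟨B, (norm_nonneg _).trans (hB' 0), fun N => ?_⟩
  have e : ∫ ω, ((X N ω ^ m).trace).re ∂(P N) = (∫ ω, (X N ω ^ m).trace ∂(P N)).re :=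
    integral_re (hA0.integrable N m)
  rw [e]
  refine (Complex.re_le_norm _).trans ?_
  rcases N.eq_zero_or_pos with rfl | hN
  · simp [Matrix.trace]
  · have h := hB' N
    have hN' : (0 : ℝ) < N := Nat.cast_pos.2 hN
    rw [norm_mul, norm_div, norm_one, Complex.norm_natCast, one_div, inv_mul_le_iff₀ hN'] at h
    linarith

theorem integrable_re_trace_pow (hA0 : HasMoments P X a α) (N m : ℕ) :
    Integrable (fun ω => ((X N ω ^ m).trace).re) (P N) :=
  (hA0.integrable N m).re

theorem exists_fourth_moment_le (hX : IsSelfAdjointEnsemble P X) (hA0 : HasMoments P X a α)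
    (hf : Continuous f) (hfb : PolyBounded f) :
    ∃ C : ℝ, 0 ≤ C ∧ ∀ N, Integrable (fun ω => ‖linStat hX.hermitian f N ω‖ ^ 4) (P N) ∧
      ∫ ω, ‖linStat hX.hermitian f N ω‖ ^ 4 ∂(P N) ≤ C * N ^ 4 := by
  obtain ⟨D, m, hD, hle⟩ := exists_norm_linStat_pow_four_le hX.hermitian hfb
  obtain ⟨B, hB, hBle⟩ := exists_integral_trace_pow_le hA0 m
  refine ⟨D * (1 + B), by positivity, fun N => ?_⟩
  have := hX.prob N
  have hi : Integrable (fun ω => D * N ^ 3 * (N + ((X N ω ^ m).trace).re)) (P N) :=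
    ((integrable_const (N : ℝ)).add (integrable_re_trace_pow hA0 N m)).const_mul _
  have hi4 : Integrable (fun ω => ‖linStat hX.hermitian f N ω‖ ^ 4) (P N) := by
    refine hi.mono' ((measurable_linStat hX hf N).norm.pow_const 4).aestronglyMeasurable
      (Eventually.of_forall fun ω => ?_)
    rw [Real.norm_of_nonneg (by positivity)]
    exact hle N ω
  refine ⟨hi4, (integral_mono hi4 hi (hle N)).trans ?_⟩
  rw [integral_const_mul, integral_add (integrable_const _) (integrable_re_trace_pow hA0 N m)]
  simp only [integral_const, probReal_univ, one_smul]
  calc D * (N : ℝ) ^ 3 * (N + ∫ ω, ((X N ω ^ m).trace).re ∂(P N))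
      ≤ D * (N : ℝ) ^ 3 * (N + B * N) := by gcongr; exact hBle N
    _ = _ := by ring

theorem memLp_linStat (hX : IsSelfAdjointEnsemble P X) (hA0 : HasMoments P X a α)
    (hf : Continuous f) (hfb : PolyBounded f) (N : ℕ) :
    MemLp (linStat hX.hermitian f N) 2 (P N) := by
  obtain ⟨C, -, hC⟩ := exists_fourth_moment_le hX hA0 hf hfb
  have := hX.prob N
  have hm := measurable_linStat hX hf N
  rw [memLp_two_iff_integrable_sq_norm hm.aestronglyMeasurable]
  refine ((integrable_const (1 : ℝ)).add (hC N).1).mono'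
    (hm.norm.pow_const 2).aestronglyMeasurable (Eventually.of_forall fun ω => ?_)
  rw [Real.norm_of_nonneg (by positivity)]
  simp only [Pi.add_apply]
  nlinarith [sq_nonneg (‖linStat hX.hermitian f N ω‖ ^ 2 - 1)]

/-- A function vanishing on `[-M, M]` only contributes on the event `‖X_N‖ > M`. -/
theorem tendsto_integral_sq_linStat_of_eq_zero (hX : IsSelfAdjointEnsemble P X)
    (hA0 : HasMoments P X a α) (hA1 : NormConcentrated P X M) (hf : Continuous f)
    (hfb : PolyBounded f) (h0 : ∀ x ∈ Set.Icc (-M) M, f x = 0) :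
    Tendsto (fun N => ∫ ω, ‖linStat hX.hermitian f N ω‖ ^ 2 ∂(P N)) atTop (𝓝 0) := by
  obtain ⟨C, hC0, hC⟩ := exists_fourth_moment_le hX hA0 hf hfb
  have hlim : Tendsto (fun N : ℕ => C * (1 / (N : ℝ))
      + (N : ℝ) ^ 8 * (P N).real {ω | M < opNorm (X N ω)}) atTop (𝓝 0) := by
    simpa using (tendsto_one_div_atTop_nhds_zero_nat.const_mul C).add hA1
  refine squeeze_zero' (Eventually.of_forall fun N => integral_nonneg fun ω => by positivity)
    ?_ hlim
  filter_upwards [eventually_ge_atTop 1] with N hN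
  have := hX.prob N
  have hN1 : (1 : ℝ) ≤ N := by exact_mod_cast hN
  have hN0 : (0 : ℝ) < N := by linarith
  set A := toMeasurable (P N) {ω | M < opNorm (X N ω)} with hA
  have hAm : MeasurableSet A := measurableSet_toMeasurable _ _
  have hi : Integrable (fun ω => ((N : ℝ) ^ 6)⁻¹ * ‖linStat hX.hermitian f N ω‖ ^ 4
      + A.indicator (fun _ => (N : ℝ) ^ 6) ω) (P N) :=
    ((hC N).1.const_mul _).add ((integrable_const _).indicator hAm)
  have hpt (ω) : ‖linStat hX.hermitian f N ω‖ ^ 2 ≤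
      ((N : ℝ) ^ 6)⁻¹ * ‖linStat hX.hermitian f N ω‖ ^ 4
        + A.indicator (fun _ => (N : ℝ) ^ 6) ω := by
    by_cases hω : M < opNorm (X N ω)
    · have : ω ∈ A := subset_toMeasurable _ _ hω
      rw [Set.indicator_of_mem this]
      have hp : (0 : ℝ) < (N : ℝ) ^ 6 := by positivity
      -- the inequality `z² ≤ z⁴ / t + t`, balanced so that both terms tend to zero
      rw [inv_mul_eq_div, ← sub_nonneg, div_add' _ _ _ hp.ne', div_sub' hp.ne']
      apply div_nonneg _ hp.le
      nlinarith [sq_nonneg (‖linStat hX.hermitian f N ω‖ ^ 2 - (N : ℝ) ^ 6),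
        sq_nonneg (‖linStat hX.hermitian f N ω‖ ^ 2), sq_nonneg ((N : ℝ) ^ 6)]
    · have hz : linStat hX.hermitian f N ω = 0 := by
        rw [linStat_apply]
        exact Finset.sum_eq_zero fun k _ => h0 _ (abs_le.1
          ((abs_eigenvalues_le_opNorm (hX.hermitian N ω) k).trans (not_lt.1 hω)))
      rw [hz]
      simpa using Set.indicator_nonneg (fun _ _ => by positivity) ω
  refine (integral_mono (((memLp_linStat hX hA0 hf hfb N).norm).integrable_sq) hi hpt).trans ?_
  rw [integral_add ((hC N).1.const_mul _) ((integrable_const _).indicator hAm),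
    integral_const_mul, integral_indicator_const _ hAm, smul_eq_mul, hA, measureReal_def,
    measure_toMeasurable, ← measureReal_def, mul_comm ((P N).real _)]
  refine add_le_add ?_ ?_
  · calc ((N : ℝ) ^ 6)⁻¹ * ∫ ω, ‖linStat hX.hermitian f N ω‖ ^ 4 ∂(P N)
        ≤ ((N : ℝ) ^ 6)⁻¹ * (C * N ^ 4) := mul_le_mul_of_nonneg_left (hC N).2 (by positivity)
      _ = C * (1 / (N : ℝ) ^ 2) := by field_simp
      _ ≤ C * (1 / (N : ℝ)) := by
        refine mul_le_mul_of_nonneg_left ?_ hC0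
        exact one_div_le_one_div_of_le hN0 (le_self_pow₀ hN1 (by norm_num))
  · exact mul_le_mul_of_nonneg_right (pow_le_pow_right₀ hN1 (by norm_num)) measureReal_nonneg

theorem sdev_linStat_le (hX : ∀ N ω, (X N ω).IsHermitian) (hK : 0 ≤ K)
    (hA2 : PoincareBound P hX K) (hf : ContDiff ℝ 1 f) {L : ℝ} (hL : ∀ x, ‖deriv f x‖ ≤ L)
    (N : ℕ) : sdev (P N) (linStat hX f N) ≤ √ K * L := by
  have hL0 : 0 ≤ L := (norm_nonneg _).trans (hL 0)
  have h : var (P N) (linStat hX f N) ≤ ENNReal.ofReal (K * L ^ 2) := by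
    refine (hA2 f hf N).trans ?_
    rw [ENNReal.ofReal_mul hK, ENNReal.ofReal_pow hL0]
    gcongr
    refine iSup_le fun x => ?_
    rw [← ofReal_norm]
    exact ENNReal.ofReal_le_ofReal (hL x)
  rw [sdev, Real.sqrt_le_left (by positivity), mul_pow, Real.sq_sqrt hK]
  exact ENNReal.toReal_le_of_le_ofReal (by positivity) h

end Ensemble

/-! ### Polynomially bounded `C¹` functions -/

/-- Test functions: the polynomially bounded functions in `C¹(ℝ)`. -/
structure IsTest (f : ℝ → ℂ) : Prop where
  contDiff : ContDiff ℝ 1 f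
  polyBounded : PolyBounded f

theorem PolyBounded.add {f g : ℝ → ℂ} (hf : PolyBounded f) (hg : PolyBounded g) :
    PolyBounded fun x => f x + g x := by
  obtain ⟨C, k, hC⟩ := hf
  obtain ⟨D, l, hD⟩ := hg
  refine ⟨|C| + |D|, max k l, fun x => ?_⟩
  have h1 : (1 : ℝ) ≤ 1 + |x| := by linarith [abs_nonneg x]
  calc ‖f x + g x‖ ≤ ‖f x‖ + ‖g x‖ := norm_add_le _ _
    _ ≤ |C| * (1 + |x|) ^ k + |D| * (1 + |x|) ^ l := by
        gcongr
        · exact (hC x).trans (by gcongr; exact le_abs_self C)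
        · exact (hD x).trans (by gcongr; exact le_abs_self D)
    _ ≤ |C| * (1 + |x|) ^ max k l + |D| * (1 + |x|) ^ max k l := by
        gcongr <;> first | exact h1 | simp
    _ = _ := by ring

theorem PolyBounded.const_mul {f : ℝ → ℂ} (hf : PolyBounded f) (c : ℂ) :
    PolyBounded fun x => c * f x := by
  obtain ⟨C, k, hC⟩ := hf
  refine ⟨‖c‖ * C, k, fun x => ?_⟩
  rw [norm_mul, mul_assoc]
  exact mul_le_mul_of_nonneg_left (hC x) (norm_nonneg c)

theorem PolyBounded.eval (p : ℂ[X]) : PolyBounded fun x => p.eval (x : ℂ) := by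
  induction p using Polynomial.induction_on' with
  | add p q hp hq => simpa using hp.add hq
  | monomial n c =>
    refine ⟨‖c‖, n, fun x => ?_⟩
    simp only [Polynomial.eval_monomial]
    rw [norm_mul, norm_pow, Complex.norm_real, Real.norm_eq_abs]
    gcongr
    linarith

theorem PolyBounded.of_norm_deriv_le {f : ℝ → ℂ} (hf : Differentiable ℝ f) {L : ℝ}
    (hL : ∀ x, ‖deriv f x‖ ≤ L) : PolyBounded f := by
  refine ⟨‖f 0‖ + L, 1, fun x => ?_⟩
  have hL0 : 0 ≤ L := (norm_nonneg _).trans (hL 0)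
  have h := Convex.norm_image_sub_le_of_norm_deriv_le (s := Set.univ) (𝕜 := ℝ)
    (fun x _ => hf x) (fun x _ => hL x) convex_univ (Set.mem_univ 0) (Set.mem_univ x)
  rw [sub_zero, Real.norm_eq_abs] at h
  have h2 : ‖f x‖ ≤ ‖f 0‖ + ‖f x - f 0‖ := by
    simpa using norm_add_le (f 0) (f x - f 0)
  nlinarith [mul_nonneg (norm_nonneg (f 0)) (abs_nonneg x)]

namespace IsTest

variable {f g : ℝ → ℂ}

theorem continuous (hf : IsTest f) : Continuous f := hf.contDiff.continuous

theorem differentiableAt (hf : IsTest f) (x : ℝ) : DifferentiableAt ℝ f x :=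
  hf.contDiff.differentiable (by norm_num) x

theorem add (hf : IsTest f) (hg : IsTest g) : IsTest fun x => f x + g x :=
  ⟨hf.contDiff.add hg.contDiff, hf.polyBounded.add hg.polyBounded⟩

theorem const_mul (hf : IsTest f) (c : ℂ) : IsTest fun x => c * f x :=
  ⟨contDiff_const.mul hf.contDiff, hf.polyBounded.const_mul c⟩

theorem sub (hf : IsTest f) (hg : IsTest g) : IsTest fun x => f x - g x := by
  simpa [sub_eq_add_neg] using hf.add (hg.const_mul (-1))

theorem eval (p : ℂ[X]) : IsTest fun x => p.eval (x : ℂ) :=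
  ⟨contDiff_polyFun p, PolyBounded.eval p⟩

theorem conj (hf : IsTest f) : IsTest fun x => starRingEnd ℂ (f x) := by
  refine ⟨Complex.conjCLE.contDiff.comp hf.contDiff, ?_⟩
  obtain ⟨C, k, hC⟩ := hf.polyBounded
  exact ⟨C, k, fun x => by rw [RCLike.norm_conj]; exact hC x⟩

end IsTest

theorem contDiff_integral {h : ℝ → ℂ} (hh : Continuous h) :
    ContDiff ℝ 1 fun x => ∫ t in (0 : ℝ)..x, h t := by
  rw [contDiff_one_iff_deriv]
  refine ⟨fun x => (hh.integral_hasStrictDerivAt 0 x).hasDerivAt.differentiableAt, ?_⟩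
  rwa [funext fun x => Continuous.deriv_integral h hh 0 x]

/-- A function in `C¹(ℝ)` can be altered off `[-M, M]`, continuing it affinely, so as not to
increase the supremum of its derivative. -/
theorem exists_isTest_eqOn {M : ℝ} (hM : 0 < M) {f : ℝ → ℂ} (hf : ContDiff ℝ 1 f) {L : ℝ}
    (hL : ∀ x ∈ Set.Icc (-M) M, ‖deriv f x‖ ≤ L) :
    ∃ F : ℝ → ℂ, IsTest F ∧ (∀ x ∈ Set.Icc (-M) M, F x = f x) ∧ ∀ x, ‖deriv F x‖ ≤ L := by
  set h : ℝ → ℂ := fun t => deriv f (max (-M) (min M t)) with hh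
  have hf' : Continuous (deriv f) := hf.continuous_deriv le_rfl
  have hc : Continuous h := by fun_prop
  have hd (x : ℝ) : deriv (fun x => f 0 + ∫ t in (0 : ℝ)..x, h t) x = h x := by
    rw [deriv_const_add, Continuous.deriv_integral h hc 0 x]
  have hbd (x : ℝ) : ‖deriv (fun x => f 0 + ∫ t in (0 : ℝ)..x, h t) x‖ ≤ L := by
    rw [hd]
    exact hL _ ⟨le_max_left _ _, max_le (by linarith) (min_le_left _ _)⟩
  have hC : ContDiff ℝ 1 fun x => f 0 + ∫ t in (0 : ℝ)..x, h t :=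
    contDiff_const.add (contDiff_integral hc)
  refine ⟨fun x => f 0 + ∫ t in (0 : ℝ)..x, h t,
    ⟨hC, .of_norm_deriv_le (hC.differentiable (by norm_num)) hbd⟩, fun x hx => ?_, hbd⟩
  have : ∫ t in (0 : ℝ)..x, h t = ∫ t in (0 : ℝ)..x, deriv f t := by
    refine intervalIntegral.integral_congr fun t ht => ?_
    have ht' : t ∈ Set.Icc (-M) M :=
      Set.uIcc_subset_Icc ⟨by linarith, hM.le⟩ hx ht
    simp only [hh, min_eq_right ht'.2, max_eq_right ht'.1]
  simp only [this]
  rw [intervalIntegral.integral_deriv_eq_sub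
    (fun t _ => hf.differentiable (by norm_num) t) (hf'.intervalIntegrable _ _)]
  ring

/-! ### The space `C¹([-M, M])` -/

section Segment

variable {M : ℝ}

theorem dSeg_eq_deriv (hM : 0 < M) {h : Seg M → ℂ} {F : ℝ → ℂ} (hF : Differentiable ℝ F)
    (e : ∀ x : Seg M, h x = F x) (x : Seg M) : dSeg h x = deriv F x := by
  have hE : Set.EqOn (Function.extend Subtype.val h 0) F (Set.Icc (-M) M) := fun y hy => by
    rw [← e ⟨y, hy⟩]
    exact Subtype.val_injective.extend_apply h 0 ⟨y, hy⟩
  rw [dSeg, derivWithin_congr hE (hE x.2)]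
  exact (hF x).derivWithin (uniqueDiffOn_Icc (by linarith) x x.2)

theorem continuous_dSeg (hM : 0 < M) (h : C1 M) : Continuous (dSeg h.1) := by
  obtain ⟨F, hF, e⟩ := h.2
  rw [funext (dSeg_eq_deriv hM (hF.differentiable (by norm_num)) e)]
  exact (hF.continuous_deriv le_rfl).comp continuous_subtype_val

/-- Differentiation on `[-M, M]` as a linear map. -/
noncomputable def derivSeg (hM : 0 < M) : C1 M →ₗ[ℂ] Seg M → ℂ where
  toFun h := dSeg h.1
  map_add' h k := funext fun x => by
    obtain ⟨F, hF, e⟩ := h.2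
    obtain ⟨G, hG, e'⟩ := k.2
    have dF := hF.differentiable (n := 1) (by norm_num)
    have dG := hG.differentiable (n := 1) (by norm_num)
    rw [Pi.add_apply, dSeg_eq_deriv hM dF e, dSeg_eq_deriv hM dG e']
    refine (dSeg_eq_deriv hM (dF.add dG) (fun x => congrArg₂ (· + ·) (e x) (e' x)) x).trans ?_
    exact deriv_add (dF x) (dG x)
  map_smul' c h := funext fun x => by
    obtain ⟨F, hF, e⟩ := h.2
    have dF := hF.differentiable (n := 1) (by norm_num)
    rw [Pi.smul_apply, dSeg_eq_deriv hM dF e]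
    refine (dSeg_eq_deriv hM (dF.const_mul c) (fun x => congrArg (c * ·) (e x)) x).trans ?_
    exact deriv_const_mul c (dF x)

theorem derivSeg_apply (hM : 0 < M) (h : C1 M) : derivSeg hM h = dSeg h.1 := rfl

theorem norm_le_supNorm {f : Seg M → ℂ} (hf : Continuous f) (x : Seg M) : ‖f x‖ ≤ supNorm f :=
  le_ciSup (isCompact_range hf.norm).bddAbove x

theorem supNorm_nonneg (f : Seg M → ℂ) : 0 ≤ supNorm f :=
  Real.iSup_nonneg fun _ => norm_nonneg _

theorem supNorm_le {f : Seg M → ℂ} {L : ℝ} (hL : 0 ≤ L) (h : ∀ x, ‖f x‖ ≤ L) : supNorm f ≤ L :=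
  Real.iSup_le h hL

/-- Every element of `C¹([-M, M])` extends to a test function whose derivative is bounded by
`‖h'‖_M` on the whole line. -/
theorem exists_extension (hM : 0 < M) (h : C1 M) :
    ∃ F : ℝ → ℂ, IsTest F ∧ (∀ x : Seg M, h.1 x = F x) ∧
      ∀ x, ‖deriv F x‖ ≤ supNorm (dSeg h.1) := by
  obtain ⟨G, hG, e⟩ := h.2
  obtain ⟨F, hF, e', hb⟩ := exists_isTest_eqOn hM hG (L := supNorm (dSeg h.1)) fun x hx => by
    rw [← dSeg_eq_deriv hM (hG.differentiable (by norm_num)) e ⟨x, hx⟩]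
    exact norm_le_supNorm (continuous_dSeg hM h) _
  exact ⟨F, hF, fun x => (e x).trans (e' x x.2).symm, hb⟩

end Segment

/-! ### Limits of covariances -/

theorem cauchySeq_of_forall_exists_cauchySeq {c : ℕ → ℂ}
    (h : ∀ ε > 0, ∃ d : ℕ → ℂ, CauchySeq d ∧ ∀ᶠ N in atTop, ‖c N - d N‖ ≤ ε) : CauchySeq c := by
  rw [Metric.cauchySeq_iff']
  intro ε hε
  obtain ⟨d, hd, hcd⟩ := h (ε / 4) (by positivity)
  obtain ⟨N₁, h₁⟩ := Metric.cauchySeq_iff'.1 hd (ε / 4) (by positivity)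
  obtain ⟨N₂, h₂⟩ := eventually_atTop.1 hcd
  refine ⟨max N₁ N₂, fun n hn => ?_⟩
  have a1 := h₁ n ((le_max_left _ _).trans hn)
  have a2 := h₁ (max N₁ N₂) (le_max_left _ _)
  have a3 := h₂ n ((le_max_right _ _).trans hn)
  have a4 := h₂ (max N₁ N₂) (le_max_right _ _)
  rw [← dist_eq_norm] at a3 a4
  have b1 := dist_triangle4 (c n) (d n) (d (max N₁ N₂)) (c (max N₁ N₂))
  have b2 := dist_triangle_right (d n) (d (max N₁ N₂)) (d N₁)
  rw [dist_comm (d (max N₁ N₂)) (c _)] at b1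
  linarith

section Ensemble

variable {Ω : ℕ → Type*} [∀ N, MeasurableSpace (Ω N)] {P : ∀ N, Measure (Ω N)}
  {X : ∀ N, Ω N → Matrix (Fin N) (Fin N) ℂ} {a : ℕ → ℂ} {α : ℕ → ℕ → ℂ} {M K : ℝ} {f g : ℝ → ℂ}

theorem IsTest.memLp_linStat (hf : IsTest f) (hX : IsSelfAdjointEnsemble P X)
    (hA0 : HasMoments P X a α) (N : ℕ) : MemLp (linStat hX.hermitian f N) 2 (P N) :=
  SecondOrder.memLp_linStat hX hA0 hf.continuous hf.polyBounded N

theorem memLp_trace_pow (hX : IsSelfAdjointEnsemble P X) (hA0 : HasMoments P X a α) (N m : ℕ) :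
    MemLp (fun ω => (X N ω ^ m).trace) 2 (P N) := by
  have h := (IsTest.eval (Polynomial.X ^ m)).memLp_linStat hX hA0 N
  have e : linStat hX.hermitian (fun x => (Polynomial.X ^ m : ℂ[X]).eval (x : ℂ)) N
      = fun ω => (X N ω ^ m).trace := funext fun ω => by
    simp [linStat_apply, trace_pow_eq_sum_eigenvalues (hX.hermitian N ω)]
  rwa [e] at h

theorem tendsto_cov_eval (hX : IsSelfAdjointEnsemble P X) (hA0 : HasMoments P X a α)
    (p q : ℂ[X]) : Tendsto (fun N => cov (P N) (linStat hX.hermitian (fun x => p.eval (x : ℂ)) N)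
      (linStat hX.hermitian (fun x => q.eval (x : ℂ)) N)) atTop (𝓝 (polyRho α p q)) := by
  have e (N) : cov (P N) (linStat hX.hermitian (fun x => p.eval (x : ℂ)) N)
      (linStat hX.hermitian (fun x => q.eval (x : ℂ)) N) = ∑ m ∈ p.support, ∑ n ∈ q.support,
        p.coeff m * q.coeff n *
          cov (P N) (fun ω => (X N ω ^ m).trace) (fun ω => (X N ω ^ n).trace) := by
    have := hX.prob N
    have hm (c : ℂ) (m : ℕ) : MemLp (fun ω => c * (X N ω ^ m).trace) 2 (P N) :=
      (memLp_trace_pow hX hA0 N m).const_mul c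
    rw [linStat_eval, linStat_eval, cov_sum_left _ (fun m _ => hm _ m)
      (memLp_finsetSum _ fun n _ => hm _ n)]
    refine Finset.sum_congr rfl fun m _ => ?_
    rw [cov_comm, cov_sum_left _ (fun n _ => hm _ n) (hm _ m)]
    refine Finset.sum_congr rfl fun n _ => ?_
    rw [cov_const_mul_left, cov_comm, cov_const_mul_left]
    ring
  simp only [e]
  exact tendsto_finsetSum _ fun m _ => tendsto_finsetSum _ fun n _ =>
    (hA0.second m n).const_mul _

/-- Asymptotically, the Poincaré inequality only sees `f'` on `[-M, M]`: `f` may be replaced by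
its affine continuation, as the variance of the difference tends to zero. -/
theorem IsTest.eventually_sdev_le (hf : IsTest f) (hX : IsSelfAdjointEnsemble P X)
    (hA0 : HasMoments P X a α) (hM : 0 < M) (hA1 : NormConcentrated P X M) (hK : 0 ≤ K)
    (hA2 : PoincareBound P hX.hermitian K) {L : ℝ}
    (hL : ∀ x ∈ Set.Icc (-M) M, ‖deriv f x‖ ≤ L) {ε : ℝ} (hε : 0 < ε) :
    ∀ᶠ N in atTop, sdev (P N) (linStat hX.hermitian f N) ≤ √ K * L + ε := by
  obtain ⟨F, hF, e, hb⟩ := exists_isTest_eqOn hM hf.contDiff hL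
  have hd := hf.sub hF
  have h0 := tendsto_integral_sq_linStat_of_eq_zero hX hA0 hA1 hd.continuous hd.polyBounded
    fun x hx => sub_eq_zero.2 (e x hx).symm
  have h1 := (h0.sqrt).const_mul 2
  rw [Real.sqrt_zero, mul_zero] at h1
  filter_upwards [h1.eventually_le_const hε] with N hN
  have := hX.prob N
  have e2 : linStat hX.hermitian f N = fun ω => linStat hX.hermitian F N ω
      + linStat hX.hermitian (fun x => f x - F x) N ω := by
    rw [← linStat_add]
    simp
  rw [e2]
  refine (sdev_add_le (hF.memLp_linStat hX hA0 N) (hd.memLp_linStat hX hA0 N)).trans ?_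
  exact add_le_add (sdev_linStat_le hX.hermitian hK hA2 hF.contDiff hb N)
    ((sdev_le_two_mul_sqrt (hd.memLp_linStat hX hA0 N)).trans hN)

theorem IsTest.eventually_norm_cov_le (hf : IsTest f) (hg : IsTest g)
    (hX : IsSelfAdjointEnsemble P X)
    (hA0 : HasMoments P X a α) (hM : 0 < M) (hA1 : NormConcentrated P X M) (hK : 0 ≤ K)
    (hA2 : PoincareBound P hX.hermitian K) {L L' : ℝ}
    (hL : ∀ x ∈ Set.Icc (-M) M, ‖deriv f x‖ ≤ L)
    (hL' : ∀ x ∈ Set.Icc (-M) M, ‖deriv g x‖ ≤ L') {ε ε' : ℝ} (hε : 0 < ε) (hε' : 0 < ε') :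
    ∀ᶠ N in atTop, ‖cov (P N) (linStat hX.hermitian f N) (linStat hX.hermitian g N)‖
      ≤ (√ K * L + ε) * (√ K * L' + ε') := by
  filter_upwards [hf.eventually_sdev_le hX hA0 hM hA1 hK hA2 hL hε,
    hg.eventually_sdev_le hX hA0 hM hA1 hK hA2 hL' hε'] with N h1 h2
  have := hX.prob N
  exact (norm_cov_le (hf.memLp_linStat hX hA0 N) (hg.memLp_linStat hX hA0 N)).trans
    (mul_le_mul h1 h2 sdev_nonneg (sdev_nonneg.trans h1))

theorem IsTest.norm_le_of_tendsto_cov (hf : IsTest f) (hg : IsTest g)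
    (hX : IsSelfAdjointEnsemble P X)
    (hA0 : HasMoments P X a α) (hM : 0 < M) (hA1 : NormConcentrated P X M) (hK : 0 ≤ K)
    (hA2 : PoincareBound P hX.hermitian K) {L L' : ℝ}
    (hL : ∀ x ∈ Set.Icc (-M) M, ‖deriv f x‖ ≤ L)
    (hL' : ∀ x ∈ Set.Icc (-M) M, ‖deriv g x‖ ≤ L') {l : ℂ}
    (hl : Tendsto (fun N => cov (P N) (linStat hX.hermitian f N) (linStat hX.hermitian g N))
      atTop (𝓝 l)) : ‖l‖ ≤ K * L * L' := by
  have h (ε : ℝ) (hε : 0 < ε) : ‖l‖ ≤ (√ K * L + ε) * (√ K * L' + ε) :=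
    le_of_tendsto hl.norm
      (hf.eventually_norm_cov_le hg hX hA0 hM hA1 hK hA2 hL hL' hε hε)
  have hc : Tendsto (fun ε : ℝ => (√ K * L + ε) * (√ K * L' + ε)) (𝓝[>] 0)
      (𝓝 ((√ K * L + 0) * (√ K * L' + 0))) :=
    tendsto_nhdsWithin_of_tendsto_nhds (Continuous.tendsto (by fun_prop) 0)
  have := ge_of_tendsto hc (eventually_nhdsWithin_of_forall h)
  calc ‖l‖ ≤ _ := this
    _ = (√ K * √ K) * L * L' := by ring
    _ = _ := by rw [Real.mul_self_sqrt hK]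

theorem exists_polynomial_deriv_near (hf : ContDiff ℝ 1 f) (a b : ℝ) {ε : ℝ} (hε : 0 < ε) :
    ∃ p : ℂ[X], ∀ x ∈ Set.Icc a b, ‖deriv (fun x => f x - p.eval (x : ℂ)) x‖ ≤ ε := by
  obtain ⟨q, hq⟩ := exists_complex_polynomial_near (hf.continuous_deriv le_rfl) a b hε
  obtain ⟨p, rfl⟩ := exists_derivative_eq q
  refine ⟨p, fun x hx => ?_⟩
  have h1 : HasDerivAt (fun x : ℝ => p.eval (x : ℂ)) (p.derivative.eval (x : ℂ)) x :=
    (p.hasDerivAt (x : ℂ)).comp_ofReal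
  have h2 := (hf.differentiable (by norm_num) x).hasDerivAt.sub h1
  rw [HasDerivAt.deriv (f := fun x : ℝ => f x - p.eval (x : ℂ)) h2, norm_sub_rev]
  exact (hq x hx).le

theorem cov_sub_cov (hf : IsTest f) (hg : IsTest g) {p q : ℝ → ℂ} (hp : IsTest p)
    (hq : IsTest q) (hX : IsSelfAdjointEnsemble P X) (hA0 : HasMoments P X a α) (N : ℕ) :
    cov (P N) (linStat hX.hermitian f N) (linStat hX.hermitian g N)
      - cov (P N) (linStat hX.hermitian p N) (linStat hX.hermitian q N) =
    cov (P N) (linStat hX.hermitian (fun x => f x - p x) N) (linStat hX.hermitian g N)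
      + cov (P N) (linStat hX.hermitian p N) (linStat hX.hermitian (fun x => g x - q x) N) := by
  have := hX.prob N
  have key {f g p : ℝ → ℂ} (hf : IsTest f) (hg : IsTest g) (hp : IsTest p) :
      cov (P N) (linStat hX.hermitian f N) (linStat hX.hermitian g N)
        = cov (P N) (linStat hX.hermitian (fun x => f x - p x) N) (linStat hX.hermitian g N)
          + cov (P N) (linStat hX.hermitian p N) (linStat hX.hermitian g N) := by
    rw [← cov_add_left ((hf.sub hp).memLp_linStat hX hA0 N) (hp.memLp_linStat hX hA0 N)
      (hg.memLp_linStat hX hA0 N), ← linStat_add]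
    simp
  rw [key hf hg hp, cov_comm (linStat hX.hermitian p N) (linStat hX.hermitian g N),
    key hg hp hq, cov_comm (linStat hX.hermitian q N), cov_comm (linStat hX.hermitian p N)
      (linStat hX.hermitian (fun x => g x - q x) N)]
  ring

theorem exists_norm_deriv_le (hf : ContDiff ℝ 1 f) (a b : ℝ) :
    ∃ L, 0 ≤ L ∧ ∀ x ∈ Set.Icc a b, ‖deriv f x‖ ≤ L := by
  obtain ⟨L, hL⟩ := (isCompact_Icc (a := a) (b := b)).exists_bound_of_continuousOn
    (hf.continuous_deriv le_rfl).continuousOn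
  exact ⟨max L 0, le_max_right _ _, fun x hx => (hL x hx).trans (le_max_left _ _)⟩

/-- The covariances converge, since for large `N` they are close to those of polynomials
whose derivatives approximate `f'` and `g'` on `[-M, M]`. -/
theorem IsTest.exists_tendsto_cov (hf : IsTest f) (hg : IsTest g)
    (hX : IsSelfAdjointEnsemble P X)
    (hA0 : HasMoments P X a α) (hM : 0 < M) (hA1 : NormConcentrated P X M) (hK : 0 ≤ K)
    (hA2 : PoincareBound P hX.hermitian K) :
    ∃ l, Tendsto (fun N => cov (P N) (linStat hX.hermitian f N) (linStat hX.hermitian g N))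
      atTop (𝓝 l) := by
  refine cauchySeq_tendsto_of_complete (cauchySeq_of_forall_exists_cauchySeq fun ε hε => ?_)
  obtain ⟨L, hL0, hL⟩ := exists_norm_deriv_le hf.contDiff (-M) M
  obtain ⟨L', hL0', hL'⟩ := exists_norm_deriv_le hg.contDiff (-M) M
  set D := (√ K + 1) * (√ K * L' + 1 + (√ K * (L + 1) + 1)) with hD
  have hDpos : 0 < D := by positivity
  set η := min 1 (ε / D) with hη
  have hη0 : 0 < η := lt_min one_pos (by positivity)
  obtain ⟨p, hp⟩ := exists_polynomial_deriv_near hf.contDiff (-M) M hη0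
  obtain ⟨q, hq⟩ := exists_polynomial_deriv_near hg.contDiff (-M) M hη0
  have tp := IsTest.eval p
  have tq := IsTest.eval q
  have hpL : ∀ x ∈ Set.Icc (-M) M, ‖deriv (fun x : ℝ => p.eval (x : ℂ)) x‖ ≤ L + 1 := by
    intro x hx
    have h1 := hp x hx
    rw [deriv_fun_sub (hf.differentiableAt x) (tp.differentiableAt x), norm_sub_rev] at h1
    have h2 := norm_add_le (deriv (fun x : ℝ => p.eval (x : ℂ)) x - deriv f x) (deriv f x)
    rw [sub_add_cancel] at h2
    linarith [hL x hx, min_le_left 1 (ε / D)]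
  refine ⟨_, (tendsto_cov_eval hX hA0 p q).cauchySeq, ?_⟩
  filter_upwards [(hf.sub tp).eventually_norm_cov_le hg hX hA0 hM hA1 hK hA2 hp hL' hη0 one_pos,
    tp.eventually_norm_cov_le (hg.sub tq) hX hA0 hM hA1 hK hA2 hpL hq one_pos hη0] with N h1 h2
  rw [cov_sub_cov hf hg tp tq hX hA0 N]
  refine (norm_add_le _ _).trans ((add_le_add h1 h2).trans ?_)
  calc _ = D * η := by rw [hD]; ring
    _ ≤ D * (ε / D) := by gcongr; exact min_le_right _ _
    _ = ε := by field_simp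

/-- The limit of the covariances depends on the restrictions to `[-M, M]` only. -/
theorem IsTest.tendsto_cov_congr (hf : IsTest f) (hg : IsTest g) {p q : ℝ → ℂ} (hp : IsTest p)
    (hq : IsTest q) (hX : IsSelfAdjointEnsemble P X)
    (hA0 : HasMoments P X a α) (hM : 0 < M) (hA1 : NormConcentrated P X M) (hK : 0 ≤ K)
    (hA2 : PoincareBound P hX.hermitian K)
    (hfp : ∀ x : Seg M, f x = p x) (hgq : ∀ x : Seg M, g x = q x) {l : ℂ}
    (hl : Tendsto (fun N => cov (P N) (linStat hX.hermitian f N) (linStat hX.hermitian g N))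
      atTop (𝓝 l)) :
    Tendsto (fun N => cov (P N) (linStat hX.hermitian p N) (linStat hX.hermitian q N))
      atTop (𝓝 l) := by
  have key {f p : ℝ → ℂ} (hf : IsTest f) (hp : IsTest p) (h : ∀ x : Seg M, f x = p x) :
      ∀ x ∈ Set.Icc (-M) M, ‖deriv (fun x => f x - p x) x‖ ≤ 0 := by
    intro x hx
    rw [deriv_fun_sub (hf.differentiableAt x) (hp.differentiableAt x)]
    rw [← dSeg_eq_deriv hM (h := fun x => p x) hp.differentiableAt (fun _ => rfl) ⟨x, hx⟩,
      ← dSeg_eq_deriv hM (h := fun x => p x) hf.differentiableAt (fun x => (h x).symm) ⟨x, hx⟩]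
    simp
  obtain ⟨l', hl'⟩ := hp.exists_tendsto_cov hq hX hA0 hM hA1 hK hA2
  obtain ⟨l₁, hl₁⟩ := (hf.sub hp).exists_tendsto_cov hg hX hA0 hM hA1 hK hA2
  obtain ⟨l₂, hl₂⟩ := hp.exists_tendsto_cov (hg.sub hq) hX hA0 hM hA1 hK hA2
  obtain ⟨L, -, hL⟩ := exists_norm_deriv_le hp.contDiff (-M) M
  obtain ⟨L', -, hL'⟩ := exists_norm_deriv_le hg.contDiff (-M) M
  have h1 := (hf.sub hp).norm_le_of_tendsto_cov hg hX hA0 hM hA1 hK hA2 (key hf hp hfp) hL' hl₁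
  have h2 := hp.norm_le_of_tendsto_cov (hg.sub hq) hX hA0 hM hA1 hK hA2 hL (key hg hq hgq) hl₂
  have e1 : l₁ = 0 := by simpa using h1
  have e2 : l₂ = 0 := by simpa using h2
  have h3 := hl.sub hl'
  simp only [cov_sub_cov hf hg hp hq hX hA0] at h3
  have h4 := tendsto_nhds_unique h3 (hl₁.add hl₂)
  rw [e1, e2, add_zero, sub_eq_zero] at h4
  rwa [h4]

/-- The limiting covariance, as a bilinear form on `C¹([-M, M])`. -/
theorem exists_limiting_cov (hX : IsSelfAdjointEnsemble P X)
    (hA0 : HasMoments P X a α) (hM : 0 < M) (hA1 : NormConcentrated P X M) (hK : 0 ≤ K)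
    (hA2 : PoincareBound P hX.hermitian K) :
    ∃ ρ : C1 M →ₗ[ℂ] C1 M →ₗ[ℂ] ℂ, ∀ (h k : C1 M) (f g : ℝ → ℂ), IsTest f → IsTest g →
      (∀ x : Seg M, h.1 x = f x) → (∀ x : Seg M, k.1 x = g x) →
      Tendsto (fun N => cov (P N) (linStat hX.hermitian f N) (linStat hX.hermitian g N))
        atTop (𝓝 (ρ h k)) := by
  choose E hE eE _ using exists_extension hM
  choose R hR using fun h k : C1 M =>
    (hE h).exists_tendsto_cov (hE k) hX hA0 hM hA1 hK hA2
  have key (h k : C1 M) (f g : ℝ → ℂ) (hf : IsTest f) (hg : IsTest g)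
      (ef : ∀ x : Seg M, h.1 x = f x) (eg : ∀ x : Seg M, k.1 x = g x) :
      Tendsto (fun N => cov (P N) (linStat hX.hermitian f N) (linStat hX.hermitian g N))
        atTop (𝓝 (R h k)) :=
    (hE h).tendsto_cov_congr (hE k) hf hg hX hA0 hM hA1 hK hA2
      (fun x => (eE h x).symm.trans (ef x)) (fun x => (eE k x).symm.trans (eg x)) (hR h k)
  have hsymm (h k : C1 M) : R h k = R k h :=
    tendsto_nhds_unique (hR h k) (by simpa only [cov_comm] using hR k h)
  have hadd (h h' k : C1 M) : R (h + h') k = R h k + R h' k := by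
    refine tendsto_nhds_unique (key (h + h') k _ _ ((hE h).add (hE h')) (hE k)
      (fun x => congrArg₂ (· + ·) (eE h x) (eE h' x)) (eE k)) (((hR h k).add (hR h' k)).congr
        fun N => ?_)
    have := hX.prob N
    rw [linStat_add, cov_add_left ((hE h).memLp_linStat hX hA0 N)
      ((hE h').memLp_linStat hX hA0 N) ((hE k).memLp_linStat hX hA0 N)]
  have hsmul (c : ℂ) (h k : C1 M) : R (c • h) k = c • R h k := by
    refine tendsto_nhds_unique (key (c • h) k _ _ ((hE h).const_mul c) (hE k)
      (fun x => congrArg (c * ·) (eE h x)) (eE k)) (((hR h k).const_mul c).congr fun N => ?_)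
    rw [linStat_const_mul, cov_const_mul_left]
  exact ⟨LinearMap.mk₂ ℂ R hadd hsmul (fun h k k' => by rw [hsymm, hadd, hsymm k, hsymm k'])
    (fun c h k => by rw [hsymm, hsmul, hsymm k]), key⟩

end Ensemble

/-! ### Fréchet's representation of bounded bilinear forms -/

section Frechet

variable {M K : ℝ}

/-- A continuous approximation, as `m → ∞`, of the indicator function of `[-M, s]`. The shift by
`(s + M) / (2 * M)`, which lies in `[0, 1]`, makes it exactly `0` for `s = -M` and exactly `1`
for `s = M` on the whole of `[-M, M]`. -/
noncomputable def ramp (M : ℝ) (m : ℕ) (s x : ℝ) : ℝ :=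
  max 0 (min 1 (m * (s - x) + (s + M) / (2 * M)))

theorem continuous_ramp (m : ℕ) (s : ℝ) : Continuous (ramp M m s) := by
  unfold ramp
  fun_prop

theorem ramp_mono (hM : 0 < M) (m : ℕ) (x : ℝ) {s t : ℝ} (h : s ≤ t) :
    ramp M m s x ≤ ramp M m t x := by
  unfold ramp
  gcongr

theorem ramp_neg (m : ℕ) {x : ℝ} (hx : -M ≤ x) : ramp M m (-M) x = 0 := by
  have : (m : ℝ) * (-M - x) ≤ 0 := mul_nonpos_of_nonneg_of_nonpos m.cast_nonneg (by linarith)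
  rw [ramp, neg_add_cancel, zero_div, add_zero]
  exact max_eq_left ((min_le_right _ _).trans this)

theorem ramp_self (hM : 0 < M) (m : ℕ) {x : ℝ} (hx : x ≤ M) : ramp M m M x = 1 := by
  have h1 : 0 ≤ (m : ℝ) * (M - x) := mul_nonneg m.cast_nonneg (by linarith)
  have h2 : (M + M) / (2 * M) = 1 := by field_simp; ring
  rw [ramp, h2, min_eq_left (by linarith), max_eq_right zero_le_one]

/-- The difference of the ramps at `t` and at `s` is supported in `(s - 1/m, t + 1/m)`. -/
theorem mul_sub_lt_of_ramp_lt (hM : 0 < M) {m : ℕ} {s t : Seg M} {x : ℝ}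
    (h : ramp M m s x < ramp M m t x) : (m : ℝ) * (s - x) < 1 ∧ (m : ℝ) * (x - t) < 1 := by
  have hs : 0 ≤ ((s : ℝ) + M) / (2 * M) := div_nonneg (by linarith [s.2.1]) (by linarith)
  have ht : ((t : ℝ) + M) / (2 * M) ≤ 1 := by
    rw [div_le_one (by linarith)]
    linarith [t.2.2]
  constructor
  · by_contra! hc
    have h1 : ramp M m t x ≤ 1 := max_le zero_le_one (min_le_left _ _)
    have h2 : ramp M m s x = 1 := by
      rw [ramp, min_eq_left (by linarith), max_eq_right zero_le_one]
    linarith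
  · by_contra! hc
    have h1 : 0 ≤ ramp M m s x := le_max_left _ _
    have h2 : ramp M m t x = 0 := by
      rw [ramp]
      refine max_eq_left ((min_le_right _ _).trans ?_)
      linarith
    linarith

/-- The antiderivative of `ramp M m s` as an element of `C¹([-M, M])`. -/
noncomputable def rampInt (M : ℝ) (m : ℕ) (s : ℝ) : C1 M :=
  restr M (fun x => ∫ t in (0 : ℝ)..x, (ramp M m s t : ℂ))
    (contDiff_integral (Complex.continuous_ofReal.comp (continuous_ramp m s)))

theorem dSeg_rampInt (hM : 0 < M) (m : ℕ) (s : ℝ) (x : Seg M) :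
    dSeg (rampInt M m s).1 x = (ramp M m s x : ℂ) := by
  have hc : Continuous fun t => (ramp M m s t : ℂ) :=
    Complex.continuous_ofReal.comp (continuous_ramp m s)
  exact (dSeg_eq_deriv hM ((contDiff_integral hc).differentiable (by norm_num)) (fun _ => rfl)
    x).trans (Continuous.deriv_integral _ hc 0 x)

theorem im_rampInt (m : ℕ) (s : ℝ) (x : Seg M) : ((rampInt M m s).1 x).im = 0 := by
  change (∫ t in (0 : ℝ)..x, (ramp M m s t : ℂ)).im = 0
  rw [intervalIntegral.integral_ofReal, Complex.ofReal_im]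

theorem sum_succ_sub_castSucc {n : ℕ} (f : Fin (n + 1) → ℝ) :
    ∑ i : Fin n, (f i.succ - f i.castSucc) = f (Fin.last n) - f 0 := by
  have h1 := Fin.sum_univ_succ f
  have h2 := Fin.sum_univ_castSucc f
  rw [Finset.sum_sub_distrib]
  linarith

/-- The antiderivative of a smoothed step function, with the value `c i` on the `i`-th interval
of the partition `s`. -/
noncomputable def stepInt (m : ℕ) (s : Partn M) (c : Fin s.n → ℂ) : C1 M :=
  ∑ i, c i • (rampInt M m (s.pt i.succ) - rampInt M m (s.pt i.castSucc))

theorem dSeg_stepInt (hM : 0 < M) (m : ℕ) (s : Partn M) (c : Fin s.n → ℂ) (x : Seg M) :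
    dSeg (stepInt m s c).1 x =
      ∑ i, c i * ((ramp M m (s.pt i.succ) x - ramp M m (s.pt i.castSucc) x : ℝ) : ℂ) := by
  rw [← derivSeg_apply hM, stepInt]
  simp only [map_sum, map_smul, map_sub, Finset.sum_apply, Pi.smul_apply, Pi.sub_apply,
    derivSeg_apply, dSeg_rampInt hM, smul_eq_mul, Complex.ofReal_sub]

theorem sum_ramp_sub (hM : 0 < M) (m : ℕ) (s : Partn M) (x : Seg M) :
    ∑ i : Fin s.n, (ramp M m (s.pt i.succ) x - ramp M m (s.pt i.castSucc) x) = 1 := by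
  rw [sum_succ_sub_castSucc (fun i => ramp M m (s.pt i) x), s.first, s.last,
    ramp_self hM m x.2.2, ramp_neg m x.2.1, sub_zero]

/-- The derivative of `stepInt m s c` at `x` is a convex combination of those `c i` whose interval
is close to `x`. -/
theorem norm_dSeg_stepInt_sub_le (hM : 0 < M) (m : ℕ) (s : Partn M) (c : Fin s.n → ℂ) (x : Seg M)
    (z : ℂ) {η : ℝ} (h : ∀ i, (m : ℝ) * (s.pt i.castSucc - x) < 1 →
      (m : ℝ) * (x - s.pt i.succ) < 1 → ‖c i - z‖ ≤ η) :
    ‖dSeg (stepInt m s c).1 x - z‖ ≤ η := by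
  set w : Fin s.n → ℝ := fun i => ramp M m (s.pt i.succ) x - ramp M m (s.pt i.castSucc) x with hw
  have hw0 (i) : 0 ≤ w i := sub_nonneg.2 (ramp_mono hM m x (s.mono (Fin.castSucc_le_succ i)))
  have hw1 : ∑ i, w i = 1 := sum_ramp_sub hM m s x
  have e : dSeg (stepInt m s c).1 x - z = ∑ i, (c i - z) * (w i : ℂ) := by
    simp only [sub_mul, Finset.sum_sub_distrib, ← Finset.mul_sum, ← Complex.ofReal_sum, hw1]
    rw [dSeg_stepInt hM]
    simp [hw]
  rw [e]
  calc ‖∑ i, (c i - z) * (w i : ℂ)‖ ≤ ∑ i, ‖(c i - z) * (w i : ℂ)‖ := norm_sum_le _ _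
    _ ≤ ∑ i, η * w i := by
        refine Finset.sum_le_sum fun i _ => ?_
        rw [norm_mul, Complex.norm_real, Real.norm_of_nonneg (hw0 i)]
        rcases (hw0 i).eq_or_lt with h0 | h0
        · simp [← h0]
        · obtain ⟨h1, h2⟩ := mul_sub_lt_of_ramp_lt hM (sub_pos.1 h0)
          exact mul_le_mul_of_nonneg_right (h i h1 h2) h0.le
    _ = η := by rw [← Finset.mul_sum, hw1, mul_one]

theorem supNorm_dSeg_stepInt_le (hM : 0 < M) (m : ℕ) (s : Partn M) (c : Fin s.n → ℂ) {L : ℝ}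
    (hL0 : 0 ≤ L) (hc : ∀ i, ‖c i‖ ≤ L) : supNorm (dSeg (stepInt m s c).1) ≤ L :=
  supNorm_le hL0 fun x => by
    simpa using norm_dSeg_stepInt_sub_le hM m s c x 0 (η := L) fun i _ _ => by simpa using hc i

/-- On a fine partition, the smoothed step function with values `f'(ξ i)` approximates `f'`
uniformly, once the ramps are steep enough. -/
theorem exists_supNorm_dSeg_stepInt_sub_le (hM : 0 < M) (f : C1 M) {η : ℝ} (hη : 0 < η) :
    ∃ δ > 0, ∀ s : Partn M, s.MeshLT δ → ∀ ξ : Fin s.n → Seg M, s.IsTag ξ →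
      ∀ᶠ m : ℕ in atTop,
        supNorm (dSeg (stepInt m s (fun i => dSeg f.1 (ξ i)) - f).1) ≤ η := by
  have huc := CompactSpace.uniformContinuous_of_continuous (continuous_dSeg hM f)
  obtain ⟨δ, hδ, h⟩ := Metric.uniformContinuous_iff.1 huc η hη
  refine ⟨δ / 2, by positivity, fun s hs ξ hξ => ?_⟩
  obtain ⟨m₀, hm₀⟩ := exists_nat_gt (2 / δ)
  filter_upwards [eventually_ge_atTop m₀] with m hm
  have hm' : 2 / δ < m := hm₀.trans_le (Nat.cast_le.2 hm)
  have hmpos : (0 : ℝ) < m := lt_trans (by positivity) hm'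
  have hinv : 1 / (m : ℝ) < δ / 2 := by
    rw [div_lt_iff₀ hδ] at hm'
    rw [div_lt_iff₀ hmpos]
    linarith
  refine supNorm_le hη.le fun x => ?_
  rw [← derivSeg_apply hM, map_sub, Pi.sub_apply, derivSeg_apply, derivSeg_apply]
  refine norm_dSeg_stepInt_sub_le hM m s _ x _ fun i h1 h2 => ?_
  rw [← dist_eq_norm]
  refine (h ?_).le
  rw [← lt_div_iff₀' hmpos] at h1 h2
  have a1 : (s.pt i.castSucc : ℝ) ≤ ξ i := (hξ i).1
  have a2 : (ξ i : ℝ) ≤ s.pt i.succ := (hξ i).2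
  have a3 := hs i
  rw [Subtype.dist_eq, Real.dist_eq, abs_lt]
  constructor <;> linarith

/-- The distribution function of the bilinear form `ρ` on smoothed indicator functions. -/
noncomputable def rampForm (ρ : C1 M →ₗ[ℂ] C1 M →ₗ[ℂ] ℂ) (m : ℕ) (s t : Seg M) : ℝ :=
  (ρ (rampInt M m s) (rampInt M m t)).re

/-- Riemann-Stieltjes sums for `rampForm ρ m` are values of `ρ` on smoothed step functions. -/
theorem sum_rectDiff_rampForm {ρ : C1 M →ₗ[ℂ] C1 M →ₗ[ℂ] ℂ}
    (hre : ∀ f g : C1 M, (∀ x, (f.1 x).im = 0) → (∀ x, (g.1 x).im = 0) → (ρ f g).im = 0)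
    (m : ℕ) (s t : Partn M) (c : Fin s.n → ℂ) (d : Fin t.n → ℂ) :
    ∑ i, ∑ j, c i * d j * (rectDiff (rampForm ρ m) (s.pt i.castSucc) (s.pt i.succ)
      (t.pt j.castSucc) (t.pt j.succ) : ℂ) = ρ (stepInt m s c) (stepInt m t d) := by
  have e (s t : Seg M) : (rampForm ρ m s t : ℂ) = ρ (rampInt M m s) (rampInt M m t) :=
    Complex.ext (Complex.ofReal_re _)
      ((Complex.ofReal_im _).trans (hre _ _ (im_rampInt m s) (im_rampInt m t)).symm)
  simp only [stepInt, map_sum, LinearMap.sum_apply, map_smul, LinearMap.smul_apply, map_sub,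
    LinearMap.sub_apply, smul_eq_mul, rectDiff, Complex.ofReal_sub, Complex.ofReal_add, e]
  rw [Finset.sum_comm]
  refine Finset.sum_congr rfl fun j _ => ?_
  rw [← Finset.sum_sub_distrib, Finset.mul_sum]
  exact Finset.sum_congr rfl fun i _ => by ring

/-- **Fréchet's representation theorem**: a bilinear form on `C¹([-M, M])` which is bounded in
terms of the derivatives, and real on real functions, is a Fréchet integral of the derivatives.
The integrator is a limit of the values of the form on antiderivatives of smoothed indicator
functions, along an ultrafilter; compactness provides it. -/
theorem exists_frechet_representation (hM : 0 < M) (hK : 0 ≤ K)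
    {ρ : C1 M →ₗ[ℂ] C1 M →ₗ[ℂ] ℂ}
    (hb : ∀ f g : C1 M, ‖ρ f g‖ ≤ K * supNorm (dSeg f.1) * supNorm (dSeg g.1))
    (hre : ∀ f g : C1 M, (∀ x, (f.1 x).im = 0) → (∀ x, (g.1 x).im = 0) → (ρ f g).im = 0) :
    ∃ u : Seg M → Seg M → ℝ, BoundedFrechetVariation u ∧
      ∀ f g : C1 M, HasFrechetIntegral u (dSeg f.1) (dSeg g.1) (ρ f g) := by
  have hb' {f g : C1 M} {L L' : ℝ} (hL : supNorm (dSeg f.1) ≤ L) (hL' : supNorm (dSeg g.1) ≤ L') :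
      ‖ρ f g‖ ≤ K * L * L' :=
    (hb f g).trans (mul_le_mul (mul_le_mul_of_nonneg_left hL hK) hL' (supNorm_nonneg _)
      (mul_nonneg hK ((supNorm_nonneg _).trans hL)))
  have hramp (m : ℕ) (s : Seg M) : supNorm (dSeg (rampInt M m s).1) ≤ 1 :=
    supNorm_le zero_le_one fun x => by
      rw [dSeg_rampInt hM, Complex.norm_real, ramp,
        Real.norm_of_nonneg (le_max_left _ _)]
      exact max_le zero_le_one (min_le_left _ _)
  have hlim (s t : Seg M) : ∃ c, Tendsto (fun m => rampForm ρ m s t) (hyperfilter ℕ) (𝓝 c) := by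
    obtain ⟨c, -, hc⟩ := (isCompact_Icc (a := -K) (b := K)).ultrafilter_le_nhds
      ((hyperfilter ℕ).map fun m => rampForm ρ m s t) (by
        rw [le_principal_iff]
        refine Ultrafilter.mem_map.2 (univ_mem' fun m => abs_le.1 ?_)
        simpa [rampForm] using (Complex.abs_re_le_norm _).trans (hb' (hramp m s) (hramp m t)))
    exact ⟨c, hc⟩
  choose u hu using hlim
  have hsum (s t : Partn M) (c : Fin s.n → ℂ) (d : Fin t.n → ℂ) :
      Tendsto (fun m => ρ (stepInt m s c) (stepInt m t d)) (hyperfilter ℕ)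
        (𝓝 (∑ i, ∑ j, c i * d j * (rectDiff u (s.pt i.castSucc) (s.pt i.succ)
          (t.pt j.castSucc) (t.pt j.succ) : ℂ))) := by
    simp only [← sum_rectDiff_rampForm hre]
    refine tendsto_finsetSum _ fun i _ => tendsto_finsetSum _ fun j _ => Tendsto.const_mul _ ?_
    refine (Complex.continuous_ofReal.tendsto _).comp ?_
    exact (((hu _ _).sub (hu _ _)).sub (hu _ _)).add (hu _ _)
  refine ⟨u, ⟨K, fun s t σ θ hσ hθ => ?_⟩, fun f g ε hε => ?_⟩
  · have h1 (r : ℝ) (hr : r = 1 ∨ r = -1) : ‖(r : ℂ)‖ ≤ 1 := by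
      rcases hr with rfl | rfl <;> simp
    have h := le_of_tendsto' (hsum s t (fun i => σ i) (fun j => θ j)).norm fun m =>
      hb' (supNorm_dSeg_stepInt_le hM m s _ zero_le_one fun i => h1 _ (hσ i))
        (supNorm_dSeg_stepInt_le hM m t _ zero_le_one fun j => h1 _ (hθ j))
    rw [mul_one, mul_one] at h
    rw [← Real.norm_eq_abs, ← Complex.norm_real]
    push_cast
    exact h
  · set A := supNorm (dSeg f.1) with hA
    set B := supNorm (dSeg g.1) with hB
    have hA0 : 0 ≤ A := supNorm_nonneg _
    have hB0 : 0 ≤ B := supNorm_nonneg _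
    set D := K * (A + B) + 1 with hD
    have hD0 : 0 < D := by positivity
    obtain ⟨δ₁, hδ₁, h₁⟩ := exists_supNorm_dSeg_stepInt_sub_le hM f
      (η := ε / (2 * D)) (by positivity)
    obtain ⟨δ₂, hδ₂, h₂⟩ := exists_supNorm_dSeg_stepInt_sub_le hM g
      (η := ε / (2 * D)) (by positivity)
    refine ⟨min δ₁ δ₂, lt_min hδ₁ hδ₂, fun s t hs ht ξ η hξ hη => ?_⟩
    have hle := Nat.hyperfilter_le_atTop
    have e₁ := hle (h₁ s (fun i => (hs i).trans_le (min_le_left _ _)) ξ hξ)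
    have e₂ := hle (h₂ t (fun i => (ht i).trans_le (min_le_right _ _)) η hη)
    have hfin := le_of_tendsto ((hsum s t (fun i => dSeg f.1 (ξ i))
      (fun j => dSeg g.1 (η j))).sub_const (ρ f g)).norm (b := ε / 2) (by
        filter_upwards [e₁, e₂] with m hm₁ hm₂
        set F := stepInt m s fun i => dSeg f.1 (ξ i)
        set G := stepInt m t fun j => dSeg g.1 (η j)
        have hG : supNorm (dSeg G.1) ≤ B := supNorm_dSeg_stepInt_le hM m t _ hB0 fun j =>
          norm_le_supNorm (continuous_dSeg hM g) _
        have e : ρ F G - ρ f g = ρ (F - f) G + ρ f (G - g) := by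
          simp only [map_sub, LinearMap.sub_apply]
          ring
        rw [e]
        calc ‖ρ (F - f) G + ρ f (G - g)‖
            ≤ K * (ε / (2 * D)) * B + K * A * (ε / (2 * D)) :=
              (norm_add_le _ _).trans (add_le_add (hb' hm₁ hG) (hb' le_rfl hm₂))
          _ = (D - 1) * (ε / (2 * D)) := by rw [hD]; ring
          _ ≤ D * (ε / (2 * D)) := by gcongr; linarith
          _ = ε / 2 := by field_simp)
    linarith

end Frechet

end SecondOrder

open SecondOrder
theorem theorem3p1 {Ω : ℕ → Type*} [∀ N, MeasurableSpace (Ω N)]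
    (P : ∀ N, Measure (Ω N)) (X : ∀ N, Ω N → Matrix (Fin N) (Fin N) ℂ)
    (hX : IsSelfAdjointEnsemble P X)
    (a : ℕ → ℂ) (α : ℕ → ℕ → ℂ) (hA0 : HasMoments P X a α)
    (M : ℝ) (hM : 0 < M) (hA1 : NormConcentrated P X M)
    (K : ℝ) (hK : 0 < K) (hA2 : PoincareBound P hX.hermitian K) :
    ∃ ρ : C1 M →ₗ[ℂ] C1 M →ₗ[ℂ] ℂ,
      ((∀ p q : ℂ[X], ρ (polyRestr M p) (polyRestr M q) = polyRho α p q) ∧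
        ∀ f g : C1 M, ‖ρ f g‖ ≤ K * supNorm (dSeg f.1) * supNorm (dSeg g.1)) ∧
      (∀ (f g : ℝ → ℂ) (hf : ContDiff ℝ 1 f) (hg : ContDiff ℝ 1 g),
        PolyBounded f → PolyBounded g →
        (∀ N, MemLp (linStat hX.hermitian f N) 2 (P N) ∧
          MemLp (linStat hX.hermitian g N) 2 (P N)) ∧
        Tendsto (fun N => cov (P N) (linStat hX.hermitian f N) (linStat hX.hermitian g N))
          atTop (𝓝 (ρ (restr M f hf) (restr M g hg)))) ∧
      ∃ u : Seg M → Seg M → ℝ, BoundedFrechetVariation u ∧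
        ∀ f g : C1 M, HasFrechetIntegral u (dSeg f.1) (dSeg g.1) (ρ f g) := by
  obtain ⟨ρ, hρ⟩ := exists_limiting_cov hX hA0 hM hA1 hK.le hA2
  have hbound (f g : C1 M) : ‖ρ f g‖ ≤ K * supNorm (dSeg f.1) * supNorm (dSeg g.1) := by
    obtain ⟨F, hF, eF, bF⟩ := exists_extension hM f
    obtain ⟨G, hG, eG, bG⟩ := exists_extension hM g
    exact hF.norm_le_of_tendsto_cov hG hX hA0 hM hA1 hK.le hA2 (fun x _ => bF x)
      (fun x _ => bG x) (hρ f g F G hF hG eF eG)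
  refine ⟨ρ, ⟨fun p q => ?_, hbound⟩, fun f g hf hg hfb hgb => ?_,
    exists_frechet_representation hM hK.le hbound fun f g hf hg => ?_⟩
  · exact tendsto_nhds_unique (hρ _ _ _ _ (.eval p) (.eval q) (fun _ => rfl) (fun _ => rfl))
      (tendsto_cov_eval hX hA0 p q)
  · have tf : IsTest f := ⟨hf, hfb⟩
    have tg : IsTest g := ⟨hg, hgb⟩
    exact ⟨fun N => ⟨tf.memLp_linStat hX hA0 N, tg.memLp_linStat hX hA0 N⟩,
      hρ _ _ f g tf tg (fun _ => rfl) (fun _ => rfl)⟩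
  · obtain ⟨F, hF, eF, -⟩ := exists_extension hM f
    obtain ⟨G, hG, eG, -⟩ := exists_extension hM g
    -- the complex conjugates of `F` and `G` extend the real functions `f` and `g` as well
    have h := hρ f g _ _ hF.conj hG.conj
      (fun x => by rw [← eF x, Complex.conj_eq_iff_im.2 (hf x)])
      (fun x => by rw [← eG x, Complex.conj_eq_iff_im.2 (hg x)])
    simp only [linStat_conj, cov_conj] at h
    exact Complex.conj_eq_iff_im.1 (tendsto_nhds_unique
      ((Complex.continuous_conj.tendsto _).comp (hρ f g F G hF hG eF eG)) h)
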